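/- Let $n \ge 2$ and $\varepsilon > 0$, and put $k = \lceil 2/\varepsilon \rceil$ and $\eta = \varepsilon^2/16$. **Model.** In each round $t = 1, 2, \dots, T$ an adversary chooses a monotone nondecreasing function $v_t : [n] \to [0,1]$, where $[n]=\{1,\dots,n\}$; it may use private randomness and the query points of all earlier rounds, but does not know the query of round $t$. The algorithm then queries a single point $q \in [n]$ and receives $v_t(q)$ as its only information about $v_t$. The empirical CDF is $F_T(i) = \frac1T \sum_{t=1}^T v_t(i)$. **Algorithm.** Initialize $w_{i,0} = 1/n$ for $i \in [n]$. In round $t$ let $a_{i,t} = w_{i,t-1} / \sum_{i'=1}^n w_{i',t-1}$, let $q_{j,t} = \min\{ q \in [n] : \sum_{i=1}^q a_{i,t} \ge \frac{j}{k+1} \}$ for $1 \le j \le k$, and let $q_{0,t} = 0$, $q_{k+1,t} = n+1$. Draw $m$ uniformly from $\{1,\dots,k\}$, independently of everything before and of $v_t$; query $q_{m,t}$ and receive $y = v_t(q_{m,t})$. Set $\hat y_{m,t} = k y$, $\hat y_{j,t} = 0$ for the other $1 \le j \le k$, $\hat y_{0,t} = 0$ and $\hat y_{k+1,t} = 1$.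 For every $i \in [n]$ let $$\hat\ell_t(i) = \hat y_{r,t} \text{ with } r = \max\{ 0 \le j \le k+1 : q_{j,t} \le i \}, \qquad \hat u_t(i) = \hat y_{r,t} \text{ with } r = \min\{ 0 \le j \le k+1 : q_{j,t} \ge i \},$$ and update $w_{i,t} = w_{i,t-1} (1+\eta)^{\hat u_t(i) - \hat\ell_t(i)}$. After $T$ rounds output $\hat G_T(i) = \frac{1}{2T} \sum_{t=1}^T (\hat\ell_t(i) + \hat u_t(i))$ for $i \in [n]$. **Theorem.** This algorithm has accuracy $\varepsilon$ and sample complexity $\frac{64 \ln n}{\varepsilon^3}$: for every integer $T \ge \frac{64 \ln n}{\varepsilon^3}$ and every (possibly randomized and adaptive) adversary, $$\Pr\Big[ \max_{i \in [n]} \big| \hat G_T(i) - F_T(i) \big| \le \varepsilon \Big] \ge \frac34 .$$ -/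

import Mathlib

open scoped BigOperators

universe u

noncomputable section

/-- A (possibly randomized, possibly adaptive) adversary in the threshold query model on `n` points.
`Ω` carries the private randomness of the adversary. In every round the adversary picks a monotone
function `[n] → [0,1]`, depending on its randomness and on the list of all earlier query points
(most recent first). Its own earlier functions, hence also the earlier answers, are determined by
these data. The point `i ∈ [n] = {1, …, n}` is represented by the element `i - 1` of `Fin n`. -/
structure TQMAdversary (n : ℕ) (Ω : Type u) [MeasurableSpace Ω] where
  move : Ω → List (Fin n) → Fin n → ℝ
  measurable_move : ∀ h i, Measurable (fun ω => move ω h i)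
  monotone_move : ∀ ω h, Monotone (move ω h)
  move_mem_Icc : ∀ ω h i, move ω h i ∈ Set.Icc (0 : ℝ) 1

/-- A randomized algorithm for the threshold query model with one query per round.
In every round it draws a fresh uniform element of `Fin coins`, queries one point (depending on its
state and the draw), and updates its state with the answer. `output T s` is the estimate that is
returned after `T` rounds in state `s`. -/
structure TQMAlgorithm (n : ℕ) where
  State : Type
  coins : ℕ
  init : State
  query : State → Fin coins → Fin n
  update : State → Fin coins → ℝ → State
  output : ℕ → State → Fin n → ℝ

namespace TQMAlgorithm

variable {n : ℕ} (A : TQMAlgorithm n)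

/-- The situation after some number of rounds: the state of the algorithm, the past queries (most
recent first), and the sum of the functions that the adversary has played. -/
structure Config where
  state : A.State
  history : List (Fin n)
  total : Fin n → ℝ

/-- One round against a fixed (realized) adversary strategy `s`, with draw `m`. The function of
the adversary depends on neither the current draw nor the current query, and the algorithm learns
of it only the value at the query point. -/
def step (s : List (Fin n) → Fin n → ℝ) (c : A.Config) (m : Fin A.coins) : A.Config where
  state := A.update c.state m (s c.history (A.query c.state m))
  history := A.query c.state m :: c.history
  total := fun i => c.total i + s c.history i

/-- The situation after `T` rounds, when the draws of the algorithm are `m`. -/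
def run (s : List (Fin n) → Fin n → ℝ) : (T : ℕ) → (Fin T → Fin A.coins) → A.Config
  | 0, _ => ⟨A.init, [], fun _ => 0⟩
  | T + 1, m => A.step s (run s T (fun t => m t.castSucc)) (m (Fin.last T))

/-- The estimate `G_T` returned after `T` rounds. -/
def estimate (s : List (Fin n) → Fin n → ℝ) (T : ℕ) (m : Fin T → Fin A.coins) : Fin n → ℝ :=
  A.output T (A.run s T m).state

/-- The empirical CDF `F_T = (1/T) ∑ v_t`. -/
def empiricalCDF (s : List (Fin n) → Fin n → ℝ) (T : ℕ) (m : Fin T → Fin A.coins) : Fin n → ℝ :=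
  fun i => (A.run s T m).total i / T

/-- `A` solves the threshold query model with accuracy `ε` and sample complexity `T₀`: for each
number of rounds `T ≥ T₀` and each adversary, the estimate is within `ε` of the empirical CDF with
probability at least `3/4`. The norm on `Fin n → ℝ` is the sup norm. -/
def Solves (ε T₀ : ℝ) : Prop :=
  ∀ T : ℕ, T₀ ≤ T →
    ∀ (Ω : Type u) [MeasurableSpace Ω] (μ : MeasureTheory.Measure Ω)
      [MeasureTheory.IsProbabilityMeasure μ] (adv : TQMAdversary n Ω),
      3 / 4 ≤ (μ.prod (ProbabilityTheory.uniformOn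
          (Set.univ : Set (Fin T → Fin A.coins)))).real
        {p | ‖A.estimate (adv.move p.1) T p.2 - A.empiricalCDF (adv.move p.1) T p.2‖ ≤ ε}

end TQMAlgorithm

namespace ImportWeightMW

variable {n : ℕ} [NeZero n] (k : ℕ)

/-- The normalized weights `a_i = w_i / W`. -/
def normalized (w : Fin n → ℝ) (i : Fin n) : ℝ := w i / ∑ i', w i'

/-- The candidate query `q_j = min {q ∈ [n] | ∑_{i ≤ q} a_i ≥ j / (k+1)}`. -/
def quantile (w : Fin n → ℝ) (j : ℕ) : Fin n :=
  sInf {q : Fin n | (j : ℝ) / (k + 1) ≤ ∑ i ∈ Finset.Iic q, normalized w i}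

/-- The positions `q_0 = 0`, `q_1, …, q_k ∈ {1, …, n}` and `q_{k+1} = n + 1`, as integers. -/
def position (w : Fin n → ℝ) (j : ℕ) : ℕ :=
  if j = 0 then 0 else if j = k + 1 then n + 1 else (quantile k w j : ℕ) + 1

/-- The importance-weighted answers, when `q_{m+1}` was queried (`m = 0, …, k-1`) and `y` was
answered: `ŷ_{m+1} = k y`, `ŷ_j = 0` for the other `1 ≤ j ≤ k`, `ŷ_0 = 0` and `ŷ_{k+1} = 1`. -/
def weightedAnswer (m : Fin k) (y : ℝ) (j : ℕ) : ℝ :=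
  if j = k + 1 then 1 else if j = (m : ℕ) + 1 then k * y else 0

/-- `ℓ̂(i) = ŷ_r` with `r = max {j | 0 ≤ j ≤ k+1, q_j ≤ i}`. -/
def lower (w : Fin n → ℝ) (m : Fin k) (y : ℝ) (i : Fin n) : ℝ :=
  weightedAnswer k m y (sSup {j : ℕ | j ≤ k + 1 ∧ position k w j ≤ (i : ℕ) + 1})

/-- `û(i) = ŷ_r` with `r = min {j | 0 ≤ j ≤ k+1, q_j ≥ i}`. -/
def upper (w : Fin n → ℝ) (m : Fin k) (y : ℝ) (i : Fin n) : ℝ :=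
  weightedAnswer k m y (sInf {j : ℕ | j ≤ k + 1 ∧ (i : ℕ) + 1 ≤ position k w j})

/-- The state of the algorithm: the weights `w_{i,t}`, and `∑_{s ≤ t} (ℓ̂_s(i) + û_s(i))`. -/
structure State (n : ℕ) where
  weight : Fin n → ℝ
  sum : Fin n → ℝ

end ImportWeightMW

open ImportWeightMW in
/-- The randomized multiplicative weights algorithm with importance weighting, with `k` candidate
queries per round and learning rate `η`. -/
def importWeightMW (n : ℕ) [NeZero n] (k : ℕ) (η : ℝ) : TQMAlgorithm n where
  State := ImportWeightMW.State n
  coins := k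
  init := ⟨fun _ => 1 / n, fun _ => 0⟩
  query s m := quantile k s.weight (m + 1)
  update s m y :=
    ⟨fun i => s.weight i * (1 + η) ^ (upper k s.weight m y i - lower k s.weight m y i),
      fun i => s.sum i + (lower k s.weight m y i + upper k s.weight m y i)⟩
  output T s i := 1 / (2 * T) * s.sum i

end

noncomputable section

namespace ImportWeightMW

/-! ### Geometry of the candidate queries: positions, bracketing indices, cells. -/

section Quantile

variable {n : ℕ} [NeZero n] {k : ℕ} {w : Fin n → ℝ}

/-! Fix the private randomness of the adversary. Its moves are then a function of the history, and
only the uniform draws remain. For a point `i` let `D` be the sum over the rounds of `(ℓ̂ + û)/2 -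
v` at `i`, and let `W` be the total weight. The proof follows the two potentials `exp(±λD)
(W/w_i)^κ` with `λ = 3ε²/16 = 3η` and `κ log(1+η) = λ/2`.

With this `κ`, the update of `w_i` contributes `exp(-λ(û - ℓ̂)/2)`, which turns the midpoint `(ℓ̂ +
û)/2` into `ℓ̂` in the upper potential and into `û` in the lower one. Importance weighting makes the
mean of `ℓ̂` over the draws a true value of `v` at or left of `i` (or 0), and that of `û` a value at
or right of `i` (or 1). By monotonicity these one-sided errors have no first-order cost
(`sum_exp_lower_le`, `sum_exp_upper_le`).

What is paid is the growth of `W^κ`. Jensen's inequality reduces it to `meanTilt`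
(`weightRatio_step_rpow_le`). The mean of `û - ℓ̂` is a gap of `v` between neighbouring queries;
each cell between them has normalized weight at most `1/(k+1)` and the gaps telescope to 1
(`sum_normalized_mul_gap_le`). The second-order terms come from the range `k` of the estimates and
from the correlation of the response at `i` with the growth of `W` (`meanTilt_le`, `le_meanTilt`).
Altogether each potential grows on average by at most `exp(λθ)` per round, where `θ = 13ε/24 -
ε³/256` (`isGrowthRate`).

Initially `W/w_i = n`, and always `W/w_i ≥ 1`. Markov's inequality therefore bounds the probability
of `±D > εT` by `n^κ exp(-λ(ε - θ)T) ≤ n⁻⁴` (`tail_factor_le`), and a union bound over `2n` events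
leaves `2/n³ ≤ 1/4`. This needs `ε ≤ 1`; for `ε ≥ 1` one has `k ≤ 2`, and the error in every round
is at most 1 with certainty (`abs_deviation_le`). -/

lemma sum_pos_of_weight_pos (hw : ∀ i, 0 < w i) : 0 < ∑ i, w i :=
  Finset.sum_pos (fun i _ => hw i) Finset.univ_nonempty

lemma normalized_pos (hw : ∀ i, 0 < w i) (i : Fin n) : 0 < normalized w i :=
  div_pos (hw i) (sum_pos_of_weight_pos hw)

lemma sum_normalized (hw : ∀ i, 0 < w i) : ∑ i, normalized w i = 1 := by
  unfold normalized
  rw [← Finset.sum_div, div_self (sum_pos_of_weight_pos hw).ne']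

lemma quantile_set_nonempty (hw : ∀ i, 0 < w i) {j : ℕ} (hj : j ≤ k + 1) :
    {q : Fin n | (j : ℝ) / (k + 1) ≤ ∑ i ∈ Finset.Iic q, normalized w i}.Nonempty := by
  refine ⟨⊤, ?_⟩
  have h : Finset.Iic (⊤ : Fin n) = Finset.univ := by ext; simp
  rw [Set.mem_ofPred_eq, h, sum_normalized hw, div_le_one (by positivity)]
  exact_mod_cast hj

lemma le_sum_quantile (hw : ∀ i, 0 < w i) {j : ℕ} (hj : j ≤ k + 1) :
    (j : ℝ) / (k + 1) ≤ ∑ i ∈ Finset.Iic (quantile k w j), normalized w i :=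
  csInf_mem (quantile_set_nonempty hw hj)

lemma sum_lt_of_lt_quantile {j : ℕ} {q : Fin n} (hq : q < quantile k w j) :
    ∑ i ∈ Finset.Iic q, normalized w i < (j : ℝ) / (k + 1) :=
  not_le.1 fun h => notMem_of_lt_csInf hq (OrderBot.bddBelow _) h

lemma quantile_mono (hw : ∀ i, 0 < w i) {j j' : ℕ} (h : j ≤ j') (hj' : j' ≤ k + 1) :
    quantile k w j ≤ quantile k w j' := by
  refine csInf_le (OrderBot.bddBelow _) ?_
  refine le_trans ?_ (le_sum_quantile hw hj')
  gcongr

lemma position_zero : position k w 0 = 0 := if_pos rfl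

lemma position_last : position k w (k + 1) = n + 1 := by simp [position]

lemma position_succ {m : ℕ} (hm : m < k) : position k w (m + 1) = (quantile k w (m + 1) : ℕ) + 1 := by
  simp [position, hm.ne]

lemma position_mono (hw : ∀ i, 0 < w i) {j j' : ℕ} (h : j ≤ j') (hj' : j' ≤ k + 1) :
    position k w j ≤ position k w j' := by
  unfold position
  have h1 := quantile_mono (k := k) hw h hj'
  have h2 := (quantile k w j).isLt
  rw [Fin.le_def] at h1
  split_ifs <;> omega

/-- The index `r` with `ℓ̂(i) = ŷ_r`. -/
def lowerIndex (k : ℕ) (w : Fin n → ℝ) (i : Fin n) : ℕ :=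
  sSup {j : ℕ | j ≤ k + 1 ∧ position k w j ≤ (i : ℕ) + 1}

/-- The index `r` with `û(i) = ŷ_r`. -/
def upperIndex (k : ℕ) (w : Fin n → ℝ) (i : Fin n) : ℕ :=
  sInf {j : ℕ | j ≤ k + 1 ∧ (i : ℕ) + 1 ≤ position k w j}

variable (k w) in
lemma lowerIndex_mem (i : Fin n) :
    lowerIndex k w i ≤ k + 1 ∧ position k w (lowerIndex k w i) ≤ (i : ℕ) + 1 :=
  Nat.sSup_mem (s := {j : ℕ | j ≤ k + 1 ∧ position k w j ≤ (i : ℕ) + 1})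
    ⟨0, by simp [position_zero]⟩ ⟨k + 1, fun _ h => h.1⟩

lemma le_lowerIndex {i : Fin n} {j : ℕ} (hj : j ≤ k + 1) (h : position k w j ≤ (i : ℕ) + 1) :
    j ≤ lowerIndex k w i :=
  le_csSup (s := {j : ℕ | j ≤ k + 1 ∧ position k w j ≤ (i : ℕ) + 1})
    ⟨k + 1, fun _ h => h.1⟩ ⟨hj, h⟩

variable (k w) in
lemma upperIndex_mem (i : Fin n) :
    upperIndex k w i ≤ k + 1 ∧ (i : ℕ) + 1 ≤ position k w (upperIndex k w i) :=
  Nat.sInf_mem (s := {j : ℕ | j ≤ k + 1 ∧ (i : ℕ) + 1 ≤ position k w j})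
    ⟨k + 1, le_rfl, by rw [position_last]; have := i.isLt; omega⟩

lemma upperIndex_le {i : Fin n} {j : ℕ} (hj : j ≤ k + 1) (h : (i : ℕ) + 1 ≤ position k w j) :
    upperIndex k w i ≤ j :=
  Nat.sInf_le (s := {j : ℕ | j ≤ k + 1 ∧ (i : ℕ) + 1 ≤ position k w j}) ⟨hj, h⟩

variable (k w) in
lemma lowerIndex_le (i : Fin n) : lowerIndex k w i ≤ k := by
  obtain ⟨h1, h2⟩ := lowerIndex_mem k w i
  rcases h1.lt_or_eq with h | h
  · omega
  · rw [h, position_last] at h2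
    have := i.isLt
    omega

variable (k w) in
lemma one_le_upperIndex (i : Fin n) : 1 ≤ upperIndex k w i := by
  obtain ⟨-, h2⟩ := upperIndex_mem k w i
  rcases Nat.eq_zero_or_pos (upperIndex k w i) with h | h
  · rw [h, position_zero] at h2; omega
  · exact h

/-- Either `i` lies strictly between two consecutive positions, or it is a position. -/
lemma index_cases (hw : ∀ i, 0 < w i) (i : Fin n) :
    (upperIndex k w i = lowerIndex k w i + 1 ∧ position k w (lowerIndex k w i) < (i : ℕ) + 1 ∧
      (i : ℕ) + 1 < position k w (upperIndex k w i)) ∨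
    (upperIndex k w i ≤ lowerIndex k w i ∧ position k w (lowerIndex k w i) = (i : ℕ) + 1 ∧
      position k w (upperIndex k w i) = (i : ℕ) + 1) := by
  obtain ⟨hl1, hl2⟩ := lowerIndex_mem k w i
  obtain ⟨hu1, hu2⟩ := upperIndex_mem k w i
  rcases Nat.lt_or_ge (lowerIndex k w i) (upperIndex k w i) with h | h
  · left
    have hl3 := lowerIndex_le k w i
    have a1 : position k w (lowerIndex k w i) < (i : ℕ) + 1 := by
      by_contra hc
      have := upperIndex_le hl1 (not_lt.1 hc)
      omega
    have a2 : (i : ℕ) + 1 < position k w (upperIndex k w i) := by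
      by_contra hc
      have := le_lowerIndex hu1 (not_lt.1 hc)
      omega
    refine ⟨?_, a1, a2⟩
    rcases Nat.lt_or_ge (i : ℕ) (position k w (lowerIndex k w i + 1)) with hc | hc
    · have := upperIndex_le (k := k) (w := w) (i := i) (j := lowerIndex k w i + 1) (by omega) hc
      omega
    · have := le_lowerIndex (k := k) (w := w) (i := i) (j := lowerIndex k w i + 1) (by omega) (by omega)
      omega
  · right
    have := position_mono hw h hl1
    exact ⟨h, by omega, by omega⟩

/-- The points strictly between the positions `q_c` and `q_{c+1}`. -/
def cell (k : ℕ) (w : Fin n → ℝ) (c : ℕ) : Finset (Fin n) :=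
  Finset.univ.filter fun i => position k w c < (i : ℕ) + 1 ∧ (i : ℕ) + 1 < position k w (c + 1)

lemma mem_cell {c : ℕ} {i : Fin n} : i ∈ cell k w c ↔
    position k w c < (i : ℕ) + 1 ∧ (i : ℕ) + 1 < position k w (c + 1) := by simp [cell]

lemma le_sum_position (hw : ∀ i, 0 < w i) {c : ℕ} (hc : c ≤ k) :
    (c : ℝ) / (k + 1) ≤ ∑ i ∈ Finset.univ.filter (fun i : Fin n => (i : ℕ) + 1 ≤ position k w c), normalized w i := by
  rcases c with _ | m
  · simp only [Nat.cast_zero, zero_div]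
    exact Finset.sum_nonneg fun i _ => (normalized_pos hw i).le
  · have h : Finset.univ.filter (fun i : Fin n => (i : ℕ) + 1 ≤ position k w (m + 1)) =
        Finset.Iic (quantile k w (m + 1)) := by
      ext i
      rw [position_succ (by omega), Finset.mem_filter_univ, Finset.mem_Iic, Fin.le_def]
      omega
    rw [h]
    exact le_sum_quantile hw (by omega)

lemma sum_lt_position (hw : ∀ i, 0 < w i) {c : ℕ} (hc : c ≤ k) :
    ∑ i ∈ Finset.univ.filter (fun i : Fin n => (i : ℕ) + 1 < position k w (c + 1)), normalized w i ≤ ((c : ℝ) + 1) / (k + 1) := by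
  have hpos : (0 : ℝ) ≤ ((c : ℝ) + 1) / (k + 1) := by positivity
  rcases hc.lt_or_eq with h | rfl
  · rw [position_succ h]
    rcases Nat.eq_zero_or_pos (quantile k w (c + 1) : ℕ) with h0 | h0
    · rw [Finset.filter_false_of_mem (by intro i _; omega)]
      simpa using hpos
    · have hq := (quantile k w (c + 1)).isLt
      have := sum_lt_of_lt_quantile (k := k) (w := w) (j := c + 1)
        (q := ⟨(quantile k w (c + 1) : ℕ) - 1, by omega⟩) (Fin.lt_def.2 (Nat.sub_lt h0 one_pos))
      push_cast at this
      have h : Finset.univ.filter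
          (fun i : Fin n => (i : ℕ) + 1 < (quantile k w (c + 1) : ℕ) + 1) =
          Finset.Iic ⟨(quantile k w (c + 1) : ℕ) - 1, by omega⟩ := by
        ext i
        rw [Finset.mem_filter_univ, Finset.mem_Iic, Fin.le_def]
        change _ ↔ (i : ℕ) ≤ (quantile k w (c + 1) : ℕ) - 1
        omega
      rw [h]
      exact this.le
  · rw [div_self (by positivity), ← sum_normalized hw]
    exact Finset.sum_le_sum_of_subset_of_nonneg (Finset.filter_subset _ _)
      fun i _ _ => (normalized_pos hw i).le

/-- The points up to and including `q_c` carry at least `c/(k+1)`, and those strictly before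
`q_{c+1}` at most `(c+1)/(k+1)`. Excluding both end points matters: a single heavy point may carry
almost all the weight, but it is then itself a position. -/
lemma sum_cell_le (hw : ∀ i, 0 < w i) {c : ℕ} (hc : c ≤ k) :
    ∑ i ∈ cell k w c, normalized w i ≤ 1 / (k + 1) := by
  have h1 := le_sum_position hw hc
  have h2 := sum_lt_position hw hc
  have hsub : ∑ i ∈ cell k w c, normalized w i +
      ∑ i ∈ Finset.univ.filter (fun i : Fin n => (i : ℕ) + 1 ≤ position k w c), normalized w i =
      ∑ i ∈ cell k w c ∪ Finset.univ.filter (fun i : Fin n => (i : ℕ) + 1 ≤ position k w c),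
        normalized w i := by
    rw [Finset.sum_union]
    rw [Finset.disjoint_left]
    intro i hi
    simp [mem_cell] at hi ⊢
    omega
  -- A point of the cell witnesses `q_c < q_{c+1}`. If the two quantiles coincide, the inclusion
  -- `h3` can fail, but then the cell is empty.
  rcases Finset.eq_empty_or_nonempty (cell k w c) with he | ⟨i₀, hi₀⟩
  · rw [he]; simp; positivity
  · have h3 : cell k w c ∪ Finset.univ.filter (fun i : Fin n => (i : ℕ) + 1 ≤ position k w c) ⊆
        Finset.univ.filter (fun i : Fin n => (i : ℕ) + 1 < position k w (c + 1)) := by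
      intro i hi
      simp [mem_cell] at hi hi₀ ⊢
      omega
    have h4 := Finset.sum_le_sum_of_subset_of_nonneg (f := normalized w) h3
      fun i _ _ => (normalized_pos hw i).le
    have h5 : ((c : ℝ) + 1) / (k + 1) = c / (k + 1) + 1 / (k + 1) := add_div _ _ _
    linarith

end Quantile

end ImportWeightMW

/-- Convexity of `exp` on the segment from 0 to `x`. It makes the exponentials linear in the
answers, so that sums over the draws can be evaluated. -/
lemma Real.exp_mul_le_chord {x y : ℝ} (h0 : 0 ≤ y) (h1 : y ≤ 1) :
    Real.exp (x * y) ≤ 1 + y * (Real.exp x - 1) := by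
  have h := convexOn_exp.2 (Set.mem_univ 0) (Set.mem_univ x) (sub_nonneg.2 h1) h0 (by ring)
  simp only [smul_eq_mul, mul_zero, zero_add, Real.exp_zero, mul_one] at h
  rw [mul_comm x y]
  linarith

/-- Draw `m` queries position `m + 1`. Position 0 is matched by no draw, which is consistent only
because `f 0 = 0`. -/
lemma Fin.sum_ite_val_succ_eq {k : ℕ} (r : ℕ) (hr : r ≤ k) (f : ℕ → ℝ) (h0 : f 0 = 0) :
    ∑ m : Fin k, (if (m : ℕ) + 1 = r then f r else 0) = f r := by
  rcases r with _ | r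
  · simp [h0]
  · have h : ∀ m : Fin k, ((m : ℕ) + 1 = r + 1) = (m = ⟨r, hr⟩) := by
      intro m; simp [Fin.ext_iff]
    simp_rw [h]
    simp

namespace ImportWeightMW

/-! ### One round: growth of the total weight. -/

section Round

variable {n : ℕ} [NeZero n] {k : ℕ} {w v : Fin n → ℝ}

/-- The true values `y_j = v(q_j)` at the positions, with `y_0 = 0` and `y_{k+1} = 1`. -/
def trueAnswer (k : ℕ) (w v : Fin n → ℝ) (j : ℕ) : ℝ :=
  if j = 0 then 0 else if j = k + 1 then 1 else v (quantile k w j)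

/-- The importance-weighted answers in a round in which `q_{m+1}` is queried. -/
def response (w v : Fin n → ℝ) (m : Fin k) (j : ℕ) : ℝ :=
  weightedAnswer k m (v (quantile k w (m + 1))) j

lemma trueAnswer_zero : trueAnswer k w v 0 = 0 := if_pos rfl

lemma trueAnswer_last : trueAnswer k w v (k + 1) = 1 := by simp [trueAnswer]

lemma trueAnswer_succ {m : ℕ} (hm : m < k) :
    trueAnswer k w v (m + 1) = v (quantile k w (m + 1)) := by
  simp [trueAnswer, hm.ne]

lemma trueAnswer_mem (hv : ∀ i, v i ∈ Set.Icc (0 : ℝ) 1) (j : ℕ) :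
    trueAnswer k w v j ∈ Set.Icc (0 : ℝ) 1 := by
  unfold trueAnswer
  split_ifs
  · simp
  · simp
  · exact hv _

lemma trueAnswer_mono (hw : ∀ i, 0 < w i) (hm : Monotone v) (hv : ∀ i, v i ∈ Set.Icc (0 : ℝ) 1)
    {j j' : ℕ} (h : j ≤ j') (hj' : j' ≤ k + 1) : trueAnswer k w v j ≤ trueAnswer k w v j' := by
  have h1 := hm (quantile_mono (k := k) hw h hj')
  have h2 := hv (quantile k w j)
  have h3 := hv (quantile k w j')
  simp only [Set.mem_Icc] at h2 h3
  unfold trueAnswer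
  split_ifs <;> first | omega | linarith

lemma trueAnswer_lowerIndex_le (hm : Monotone v) (hv : ∀ i, v i ∈ Set.Icc (0 : ℝ) 1)
    (i : Fin n) : trueAnswer k w v (lowerIndex k w i) ≤ v i := by
  obtain ⟨-, h⟩ := lowerIndex_mem k w i
  have h2 := lowerIndex_le k w i
  revert h h2
  rcases lowerIndex k w i with _ | m
  · intro _ _
    rw [trueAnswer_zero]
    exact (hv i).1
  · intro h h2
    rw [position_succ h2] at h
    rw [trueAnswer_succ h2]
    exact hm (Fin.le_def.2 (by omega))

lemma le_trueAnswer_upperIndex (hm : Monotone v) (hv : ∀ i, v i ∈ Set.Icc (0 : ℝ) 1)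
    (i : Fin n) : v i ≤ trueAnswer k w v (upperIndex k w i) := by
  obtain ⟨h2, h⟩ := upperIndex_mem k w i
  have h3 := one_le_upperIndex k w i
  revert h h2 h3
  rcases upperIndex k w i with _ | m
  · omega
  · intro h2 h _
    rcases Nat.lt_or_ge m k with hk | hk
    · rw [position_succ hk] at h
      rw [trueAnswer_succ hk]
      exact hm (Fin.le_def.2 (by omega))
    · obtain rfl : m = k := by omega
      rw [trueAnswer_last]
      exact (hv i).2

/-- Quantiles may be tied; this makes the gap of `v` vanish at a point that is itself a position. -/
lemma trueAnswer_eq_of_position_eq {j j' : ℕ} (hj : 1 ≤ j) (hj' : 1 ≤ j') (hk : j ≤ k)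
    (hk' : j' ≤ k) (h : position k w j = position k w j') :
    trueAnswer k w v j = trueAnswer k w v j' := by
  obtain ⟨a, rfl⟩ := Nat.exists_eq_add_of_le' hj
  obtain ⟨b, rfl⟩ := Nat.exists_eq_add_of_le' hj'
  rw [position_succ hk, position_succ hk'] at h
  rw [trueAnswer_succ hk, trueAnswer_succ hk', Fin.ext (Nat.succ_injective h)]

lemma response_last (m : Fin k) : response w v m (k + 1) = 1 := by simp [response, weightedAnswer]

lemma response_self (m : Fin k) : response w v m (m + 1) = k * trueAnswer k w v (m + 1) := by
  simp [response, weightedAnswer, trueAnswer_succ m.isLt, m.isLt.ne]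

lemma response_of_ne {m : Fin k} {j : ℕ} (h1 : j ≠ k + 1) (h2 : (m : ℕ) + 1 ≠ j) :
    response w v m j = 0 := by
  simp [response, weightedAnswer, h1, h2.symm]

/-- The factor `exp (λ (û(j) - ℓ̂(j)) / 2)` when `q_{m+1}` is queried. -/
def tilt (lam : ℝ) (w v : Fin n → ℝ) (m : Fin k) (j : Fin n) : ℝ :=
  Real.exp (lam / 2 * (response w v m (upperIndex k w j) - response w v m (lowerIndex k w j)))

/-- The mean of `tilt` with respect to the normalized weights. -/
def meanTilt (lam : ℝ) (w v : Fin n → ℝ) (m : Fin k) : ℝ :=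
  ∑ j, normalized w j * tilt lam w v m j

lemma tilt_pos (lam : ℝ) (m : Fin k) (j : Fin n) : 0 < tilt lam w v m j := Real.exp_pos _

lemma tilt_le_of_upperIndex_le (hv : ∀ i, v i ∈ Set.Icc (0 : ℝ) 1) (lam : ℝ) (m : Fin k)
    (j : Fin n) (hu : upperIndex k w j ≤ k) :
    tilt lam w v m j ≤ 1 +
      (if (m : ℕ) + 1 = upperIndex k w j then
        trueAnswer k w v (upperIndex k w j) * (Real.exp (lam * k / 2) - 1) else 0) +
      (if (m : ℕ) + 1 = lowerIndex k w j then
        trueAnswer k w v (lowerIndex k w j) * (Real.exp (-(lam * k / 2)) - 1) else 0) := by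
  have hl := lowerIndex_le k w j
  have hYu := trueAnswer_mem (k := k) (w := w) hv (upperIndex k w j)
  have hYl := trueAnswer_mem (k := k) (w := w) hv (lowerIndex k w j)
  unfold tilt
  by_cases h1 : (m : ℕ) + 1 = upperIndex k w j <;> by_cases h2 : (m : ℕ) + 1 = lowerIndex k w j
  -- Both indices name the queried position, so the responses cancel, while the two chord terms add
  -- up to `y (2 cosh - 2) ≥ 0`.
  · rw [if_pos h1, if_pos h2, ← h1, ← h2, sub_self, mul_zero, Real.exp_zero]
    rw [← h1] at hYu
    have h3 : 0 ≤ Real.exp (lam * k / 2) - 1 + (Real.exp (-(lam * k / 2)) - 1) := by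
      have := Real.one_le_cosh (lam * k / 2)
      rw [Real.cosh_eq] at this
      linarith
    have := mul_nonneg hYu.1 h3
    linarith
  · rw [if_pos h1, if_neg h2, response_of_ne (by omega) h2, ← h1, response_self]
    rw [← h1] at hYu
    have := Real.exp_mul_le_chord (x := lam * k / 2) hYu.1 hYu.2
    calc _ = Real.exp (lam * k / 2 * trueAnswer k w v (m + 1)) := by ring_nf
      _ ≤ _ := by linarith
  · rw [if_neg h1, if_pos h2, response_of_ne (by omega) h1, ← h2, response_self]
    rw [← h2] at hYl
    have := Real.exp_mul_le_chord (x := -(lam * k / 2)) hYl.1 hYl.2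
    calc _ = Real.exp (-(lam * k / 2) * trueAnswer k w v (m + 1)) := by ring_nf
      _ ≤ _ := by linarith
  · rw [if_neg h1, if_neg h2, response_of_ne (by omega) h1, response_of_ne (by omega) h2]
    simp

lemma tilt_le_of_upperIndex_eq (hv : ∀ i, v i ∈ Set.Icc (0 : ℝ) 1) {lam : ℝ} (hlam : 0 ≤ lam)
    (m : Fin k) (j : Fin n) (hu : upperIndex k w j = k + 1) :
    tilt lam w v m j ≤ Real.exp (lam / 2) +
      (if (m : ℕ) + 1 = lowerIndex k w j then
        trueAnswer k w v (lowerIndex k w j) * (Real.exp (-(lam * k / 2)) - 1) else 0) := by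
  have hl := lowerIndex_le k w j
  have hYl := trueAnswer_mem (k := k) (w := w) hv (lowerIndex k w j)
  unfold tilt
  rw [hu, response_last]
  by_cases h2 : (m : ℕ) + 1 = lowerIndex k w j
  · rw [if_pos h2, ← h2, response_self]
    rw [← h2] at hYl
    have h3 := Real.exp_mul_le_chord (x := -(lam * k / 2)) hYl.1 hYl.2
    have h4 : 1 ≤ Real.exp (lam / 2) := Real.one_le_exp (by positivity)
    have h5 : Real.exp (-(lam * k / 2) * trueAnswer k w v (m + 1)) ≤ 1 := by
      rw [Real.exp_le_one_iff, neg_mul]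
      have := hYl.1
      have : 0 ≤ lam * k / 2 * trueAnswer k w v (m + 1) := by positivity
      linarith
    calc _ = Real.exp (lam / 2) * Real.exp (-(lam * k / 2) * trueAnswer k w v (m + 1)) := by
          rw [← Real.exp_add]; ring_nf
      _ ≤ _ := by nlinarith
  · rw [if_neg h2, response_of_ne (by omega) h2]
    simp

/-- Bernoulli's inequality. The position `n + 1` answers 1 in every round instead of `k` in one
round out of `k`; this shows that the constant answer costs no more than the importance-weighted
one. -/
lemma mul_exp_sub_one_le (lam : ℝ) (k : ℕ) :
    k * (Real.exp (lam / 2) - 1) ≤ Real.exp (lam * k / 2) - 1 := by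
  have h := one_add_mul_le_pow (a := Real.exp (lam / 2) - 1)
    (by have := Real.exp_pos (lam / 2); linarith) k
  have h2 : (1 + (Real.exp (lam / 2) - 1)) ^ k = Real.exp (lam * k / 2) := by
    rw [add_sub_cancel, ← Real.exp_nat_mul]; ring_nf
  linarith

/-- The chord bounds give `y_u (eˣ - 1) + y_l (e⁻ˣ - 1)` with `x = λk/2`. This equals `sinh x (y_u -
y_l) + (cosh x - 1)(y_u + y_l)`: a drift proportional to the true gap, and a variance term in which
`y_u + y_l ≤ 2`. -/
lemma sum_tilt_le (hv : ∀ i, v i ∈ Set.Icc (0 : ℝ) 1)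
    {lam : ℝ} (hlam : 0 ≤ lam) (j : Fin n) :
    ∑ m : Fin k, tilt lam w v m j ≤ k +
      Real.sinh (lam * k / 2) *
        (trueAnswer k w v (upperIndex k w j) - trueAnswer k w v (lowerIndex k w j)) +
      (2 * Real.cosh (lam * k / 2) - 2) := by
  have hl := lowerIndex_le k w j
  have hYu := trueAnswer_mem (k := k) (w := w) hv (upperIndex k w j)
  have hYl := trueAnswer_mem (k := k) (w := w) hv (lowerIndex k w j)
  have hc := Real.one_le_cosh (lam * k / 2)
  have key : ∑ m : Fin k, tilt lam w v m j ≤ k +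
      trueAnswer k w v (upperIndex k w j) * (Real.exp (lam * k / 2) - 1) +
      trueAnswer k w v (lowerIndex k w j) * (Real.exp (-(lam * k / 2)) - 1) := by
    rcases (upperIndex_mem k w j).1.lt_or_eq with hu | hu
    · refine (Finset.sum_le_sum fun m _ => tilt_le_of_upperIndex_le hv lam m j (by omega)).trans ?_
      rw [Finset.sum_add_distrib, Finset.sum_add_distrib,
        Fin.sum_ite_val_succ_eq _ (by omega)
          (fun r => trueAnswer k w v r * (Real.exp (lam * k / 2) - 1)) (by simp [trueAnswer_zero]),
        Fin.sum_ite_val_succ_eq _ hl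
          (fun r => trueAnswer k w v r * (Real.exp (-(lam * k / 2)) - 1))
            (by simp [trueAnswer_zero])]
      simp
    · refine (Finset.sum_le_sum fun m _ => tilt_le_of_upperIndex_eq hv hlam m j hu).trans ?_
      rw [Finset.sum_add_distrib,
        Fin.sum_ite_val_succ_eq _ hl
          (fun r => trueAnswer k w v r * (Real.exp (-(lam * k / 2)) - 1))
            (by simp [trueAnswer_zero]), hu, trueAnswer_last]
      have := mul_exp_sub_one_le lam k
      simp only [Finset.sum_const, Finset.card_univ, Fintype.card_fin, nsmul_eq_mul]
      linarith
  refine key.trans ?_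
  simp only [Real.sinh_eq, Real.cosh_eq] at hc ⊢
  nlinarith [hYu.2, hYl.2]

lemma sum_normalized_mul_ite_cell (c : ℕ) (x : ℝ) :
    ∑ j, normalized w j * (if j ∈ cell k w c then x else 0) =
      x * ∑ j ∈ cell k w c, normalized w j := by
  rw [Finset.mul_sum, ← Finset.sum_filter_add_sum_filter_not Finset.univ (· ∈ cell k w c)]
  rw [Finset.sum_eq_zero (s := Finset.univ.filter (· ∉ cell k w c)), add_zero]
  · simp only [Finset.filter_univ_mem]
    exact Finset.sum_congr rfl fun j hj => by rw [if_pos hj, mul_comm]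
  · intro j hj
    rw [if_neg (Finset.mem_filter.1 hj).2, mul_zero]

/-- Only points strictly inside a cell see a nonzero gap. Each cell has weight at most `1/(k+1)`,
and the increments of `trueAnswer` telescope from 0 to 1. -/
lemma sum_normalized_mul_gap_le (hw : ∀ i, 0 < w i) (hm : Monotone v)
    (hv : ∀ i, v i ∈ Set.Icc (0 : ℝ) 1) :
    ∑ j, normalized w j *
      (trueAnswer k w v (upperIndex k w j) - trueAnswer k w v (lowerIndex k w j)) ≤
      1 / (k + 1) := by
  have hstep : ∀ c ∈ Finset.range (k + 1),
      0 ≤ trueAnswer k w v (c + 1) - trueAnswer k w v c := fun c hc =>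
    sub_nonneg.2 (trueAnswer_mono hw hm hv (Nat.le_succ c) (Finset.mem_range.1 hc))
  have hpt : ∀ j : Fin n,
      trueAnswer k w v (upperIndex k w j) - trueAnswer k w v (lowerIndex k w j) ≤
        ∑ c ∈ Finset.range (k + 1),
          if j ∈ cell k w c then trueAnswer k w v (c + 1) - trueAnswer k w v c else 0 := by
    intro j
    have hnn : ∀ c ∈ Finset.range (k + 1), 0 ≤
        if j ∈ cell k w c then trueAnswer k w v (c + 1) - trueAnswer k w v c else 0 := by
      intro c hc
      split_ifs
      · exact hstep c hc
      · exact le_rfl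
    have hl := lowerIndex_le k w j
    rcases index_cases hw j with ⟨h1, h2, h3⟩ | ⟨h1, h2, h3⟩
    · refine le_trans ?_ (Finset.single_le_sum hnn
        (Finset.mem_range.2 (Nat.lt_succ_of_le hl)))
      rw [if_pos (mem_cell.2 ⟨h2, h1 ▸ h3⟩), h1]
    · rw [trueAnswer_eq_of_position_eq (one_le_upperIndex k w j)
        ((one_le_upperIndex k w j).trans h1) (h1.trans hl) hl (h3.trans h2.symm), sub_self]
      exact Finset.sum_nonneg hnn
  calc _ ≤ ∑ j, normalized w j * ∑ c ∈ Finset.range (k + 1),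
          (if j ∈ cell k w c then trueAnswer k w v (c + 1) - trueAnswer k w v c else 0) :=
        Finset.sum_le_sum fun j _ => mul_le_mul_of_nonneg_left (hpt j) (normalized_pos hw j).le
    _ = ∑ c ∈ Finset.range (k + 1), (trueAnswer k w v (c + 1) - trueAnswer k w v c) *
          ∑ j ∈ cell k w c, normalized w j := by
        simp_rw [Finset.mul_sum]
        rw [Finset.sum_comm]
        exact Finset.sum_congr rfl fun c _ => (sum_normalized_mul_ite_cell c _).trans (Finset.mul_sum _ _ _)
    _ ≤ ∑ c ∈ Finset.range (k + 1), (trueAnswer k w v (c + 1) - trueAnswer k w v c) *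
          (1 / (k + 1)) :=
        Finset.sum_le_sum fun c hc => mul_le_mul_of_nonneg_left
          (sum_cell_le hw (Nat.lt_succ_iff.1 (Finset.mem_range.1 hc))) (hstep c hc)
    _ = 1 / (k + 1) := by
        rw [← Finset.sum_mul, Finset.sum_range_sub, trueAnswer_last, trueAnswer_zero]
        ring

/-- An upper bound for the sum of `meanTilt` over the `k` draws. -/
def tiltBound (k : ℕ) (lam : ℝ) : ℝ :=
  k + Real.sinh (lam * k / 2) / (k + 1) + (2 * Real.cosh (lam * k / 2) - 2)

lemma sum_meanTilt_le (hw : ∀ i, 0 < w i) (hm : Monotone v) (hv : ∀ i, v i ∈ Set.Icc (0 : ℝ) 1)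
    {lam : ℝ} (hlam : 0 ≤ lam) : ∑ m : Fin k, meanTilt lam w v m ≤ tiltBound k lam := by
  have hs : 0 ≤ Real.sinh (lam * k / 2) := Real.sinh_nonneg_iff.2 (by positivity)
  have hgap := mul_le_mul_of_nonneg_left (sum_normalized_mul_gap_le (k := k) hw hm hv) hs
  unfold meanTilt
  rw [Finset.sum_comm]
  calc _ ≤ ∑ j, normalized w j * (k + Real.sinh (lam * k / 2) *
        (trueAnswer k w v (upperIndex k w j) - trueAnswer k w v (lowerIndex k w j)) +
        (2 * Real.cosh (lam * k / 2) - 2)) := by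
        refine Finset.sum_le_sum fun j _ => ?_
        rw [← Finset.mul_sum]
        exact mul_le_mul_of_nonneg_left (sum_tilt_le hv hlam j) (normalized_pos hw j).le
    _ = (k + (2 * Real.cosh (lam * k / 2) - 2)) * ∑ j, normalized w j +
        Real.sinh (lam * k / 2) * ∑ j, normalized w j *
        (trueAnswer k w v (upperIndex k w j) - trueAnswer k w v (lowerIndex k w j)) := by
        rw [Finset.mul_sum, Finset.mul_sum, ← Finset.sum_add_distrib]
        exact Finset.sum_congr rfl fun j _ => by ring
    _ ≤ _ := by
        rw [sum_normalized hw, tiltBound]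
        have : Real.sinh (lam * k / 2) * (1 / (k + 1)) = Real.sinh (lam * k / 2) / (k + 1) := by
          ring
        linarith

/-- The tilt exceeds 1 only on the cell left of `q_{m+1}` and on the last cell, each of weight at
most `1/(k+1)`. The hypothesis `hmi` makes `m + 1` the last index among tied quantiles; without it a
heavy point at a tied position could be tilted upwards. -/
lemma meanTilt_le (hw : ∀ i, 0 < w i) (hv : ∀ i, v i ∈ Set.Icc (0 : ℝ) 1)
    {lam : ℝ} (hlam : 0 ≤ lam) (m : Fin k) (i : Fin n) (hmi : (m : ℕ) + 1 = lowerIndex k w i) :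
    meanTilt lam w v m ≤ 1 + (Real.exp (lam * k / 2) - 1) / k := by
  have hk : (0 : ℝ) < k := by exact_mod_cast m.pos
  have hP : 0 ≤ Real.exp (lam * k / 2) - 1 := sub_nonneg.2 (Real.one_le_exp (by positivity))
  have hN : Real.exp (-(lam * k / 2)) - 1 ≤ 0 := by
    rw [sub_nonpos, Real.exp_le_one_iff]
    have : 0 ≤ lam * k / 2 := by positivity
    linarith
  have hpt : ∀ j, tilt lam w v m j ≤ 1 +
      (if j ∈ cell k w m then Real.exp (lam * k / 2) - 1 else 0) +
      (if j ∈ cell k w k then (Real.exp (lam * k / 2) - 1) / k else 0) := by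
    intro j
    have hYu := trueAnswer_mem (k := k) (w := w) hv (upperIndex k w j)
    have hYl := trueAnswer_mem (k := k) (w := w) hv (lowerIndex k w j)
    have hd1 : 0 ≤ if j ∈ cell k w m then Real.exp (lam * k / 2) - 1 else 0 := by
      split_ifs <;> simp [hP]
    have hd2 : 0 ≤ if j ∈ cell k w k then (Real.exp (lam * k / 2) - 1) / k else 0 := by
      split_ifs
      · positivity
      · exact le_rfl
    have hd3 : (if (m : ℕ) + 1 = lowerIndex k w j then
        trueAnswer k w v (lowerIndex k w j) * (Real.exp (-(lam * k / 2)) - 1) else 0) ≤ 0 := by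
      split_ifs
      · exact mul_nonpos_of_nonneg_of_nonpos hYl.1 hN
      · exact le_rfl
    have hl := lowerIndex_le k w j
    rcases (upperIndex_mem k w j).1.lt_or_eq with hu | hu
    · by_cases h1 : (m : ℕ) + 1 = upperIndex k w j
      · rcases index_cases hw j with ⟨h2, h3, h4⟩ | ⟨h2, h3, h4⟩
        · have hjc : j ∈ cell k w m := by
            rw [mem_cell, h1]
            refine ⟨?_, h4⟩
            rwa [show (m : ℕ) = lowerIndex k w j by omega]
          have := tilt_le_of_upperIndex_le (w := w) hv lam m j (by omega)
          rw [if_pos h1] at this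
          rw [if_pos hjc]
          nlinarith [hYu.2]
        -- Here `j` is a position. Maximality of `lowerIndex k w i = m + 1` leaves no later index at
        -- that position, so both indices of `j` agree and the tilt is 1.
        · have h5 : lowerIndex k w j ≤ lowerIndex k w i := by
            refine le_lowerIndex (by omega) ?_
            rw [h3, ← h4, ← h1, hmi]
            exact (lowerIndex_mem k w i).2
          have h6 : upperIndex k w j = lowerIndex k w j := by omega
          have : tilt lam w v m j = 1 := by simp [tilt, h6]
          linarith
      · have := tilt_le_of_upperIndex_le (w := w) hv lam m j (by omega)
        rw [if_neg h1] at this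
        linarith
    · have hjc : j ∈ cell k w k := by
        rcases index_cases hw j with ⟨h2, h3, h4⟩ | ⟨h2, h3, h4⟩
        · rw [mem_cell]
          rw [hu] at h4
          exact ⟨by rwa [show lowerIndex k w j = k by omega] at h3, h4⟩
        · omega
      have h7 := tilt_le_of_upperIndex_eq hv hlam m j hu
      rw [if_pos hjc]
      have h8 : Real.exp (lam / 2) - 1 ≤ (Real.exp (lam * k / 2) - 1) / k := by
        rw [le_div_iff₀ hk, mul_comm]
        exact mul_exp_sub_one_le lam k
      linarith
  calc meanTilt lam w v m ≤ ∑ j, normalized w j * (1 +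
      (if j ∈ cell k w m then Real.exp (lam * k / 2) - 1 else 0) +
      (if j ∈ cell k w k then (Real.exp (lam * k / 2) - 1) / k else 0)) :=
        Finset.sum_le_sum fun j _ => mul_le_mul_of_nonneg_left (hpt j) (normalized_pos hw j).le
    _ = 1 + (Real.exp (lam * k / 2) - 1) * ∑ j ∈ cell k w m, normalized w j +
        (Real.exp (lam * k / 2) - 1) / k * ∑ j ∈ cell k w k, normalized w j := by
        simp_rw [mul_add, Finset.sum_add_distrib, sum_normalized_mul_ite_cell, mul_one]
        rw [sum_normalized hw]
    _ ≤ 1 + (Real.exp (lam * k / 2) - 1) * (1 / (k + 1)) +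
        (Real.exp (lam * k / 2) - 1) / k * (1 / (k + 1)) := by
        gcongr
        · exact sum_cell_le hw m.isLt.le
        · exact sum_cell_le hw le_rfl
    _ = _ := by
        field_simp
        ring

/-- Mirror image of `meanTilt_le`: the tilt falls below 1 only on the cell right of `q_{m+1}`,
provided that `m + 1` is the first index among tied quantiles, which `hmi` ensures. -/
lemma le_meanTilt (hw : ∀ i, 0 < w i) (hv : ∀ i, v i ∈ Set.Icc (0 : ℝ) 1)
    {lam : ℝ} (hlam : 0 ≤ lam) (m : Fin k) (i : Fin n) (hmi : (m : ℕ) + 1 = upperIndex k w i) :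
    1 - (1 - Real.exp (-(lam * k / 2))) / (k + 1) ≤ meanTilt lam w v m := by
  have hN : 0 ≤ 1 - Real.exp (-(lam * k / 2)) := by
    rw [sub_nonneg, Real.exp_le_one_iff]
    have : 0 ≤ lam * k / 2 := by positivity
    linarith
  have hpt : ∀ j, 1 + (if j ∈ cell k w (m + 1) then -(1 - Real.exp (-(lam * k / 2))) else 0) ≤
      tilt lam w v m j := by
    intro j
    have hl := lowerIndex_le k w j
    have hY := trueAnswer_mem (k := k) (w := w) hv (m + 1)
    have hru : 0 ≤ response w v m (upperIndex k w j) := by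
      unfold response weightedAnswer
      split_ifs
      · simp
      · have := (hv (quantile k w (m + 1))).1
        positivity
      · simp
    by_cases h1 : (m : ℕ) + 1 = lowerIndex k w j
    · rcases index_cases hw j with ⟨h2, h3, h4⟩ | ⟨h2, h3, h4⟩
      · have hjc : j ∈ cell k w (m + 1) := by
          rw [mem_cell, h1, ← h2]
          exact ⟨h3, h4⟩
        rw [if_pos hjc, tilt]
        calc _ = Real.exp (-(lam * k / 2)) := by ring
          _ ≤ _ := by
            rw [Real.exp_le_exp, ← h1, response_self]
            have h5 : lam / 2 * (k * trueAnswer k w v (m + 1)) ≤ lam / 2 * (k * 1) := by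
              gcongr
              exact hY.2
            have h7 : 0 ≤ lam / 2 * response w v m (upperIndex k w j) := by positivity
            linarith
      · have h5 : upperIndex k w i ≤ upperIndex k w j := by
          refine upperIndex_le (upperIndex_mem k w j).1 ?_
          rw [h4, ← h3, ← h1, hmi]
          exact (upperIndex_mem k w i).2
        have h6 : upperIndex k w j = lowerIndex k w j := by omega
        have h7 : tilt lam w v m j = 1 := by simp [tilt, h6]
        rw [h7]
        split_ifs <;> linarith
    · have h8 : 1 ≤ tilt lam w v m j := by
        rw [tilt, response_of_ne (by omega) h1, sub_zero]
        exact Real.one_le_exp (by positivity)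
      split_ifs <;> linarith
  calc _ = 1 - (1 - Real.exp (-(lam * k / 2))) * (1 / (k + 1)) := by ring
    _ ≤ 1 - (1 - Real.exp (-(lam * k / 2))) * ∑ j ∈ cell k w (m + 1), normalized w j := by
        gcongr
        exact sum_cell_le hw m.isLt
    _ = ∑ j, normalized w j *
        (1 + (if j ∈ cell k w (m + 1) then -(1 - Real.exp (-(lam * k / 2))) else 0)) := by
        simp_rw [mul_add, Finset.sum_add_distrib, sum_normalized_mul_ite_cell, mul_one]
        rw [sum_normalized hw]
        ring
    _ ≤ _ := Finset.sum_le_sum fun j _ =>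
        mul_le_mul_of_nonneg_left (hpt j) (normalized_pos hw j).le

end Round

end ImportWeightMW

/-! ### Iterating a one-round bound over all draws. -/

namespace TQMAlgorithm

/-- If the sum of a potential over the draws of a single round grows by a factor of at most `r`,
then its sum over the draws of `T` rounds grows by a factor of at most `r ^ T`. -/
lemma sum_potential_run_le {n : ℕ} (A : TQMAlgorithm n) (s : List (Fin n) → Fin n → ℝ)
    {I : A.Config → Prop} {Φ : A.Config → ℝ} {r : ℝ} (hr : 0 ≤ r) (hI0 : I ⟨A.init, [], fun _ => 0⟩)
    (hI : ∀ c m, I c → I (A.step s c m))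
    (hΦ : ∀ c, I c → ∑ m, Φ (A.step s c m) ≤ r * Φ c) (T : ℕ) :
    (∀ m, I (A.run s T m)) ∧ ∑ m, Φ (A.run s T m) ≤ r ^ T * Φ ⟨A.init, [], fun _ => 0⟩ := by
  induction T with
  | zero => simp [run, hI0]
  | succ T ih =>
    obtain ⟨ih1, ih2⟩ := ih
    refine ⟨fun m => hI _ _ (ih1 _), ?_⟩
    have h : ∑ m, Φ (A.run s (T + 1) m) =
        ∑ m : Fin T → Fin A.coins, ∑ a, Φ (A.step s (A.run s T m) a) := by
      -- `Fin.snocEquiv` splits off the last draw, which neither the earlier configuration nor the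
      -- current move of the adversary depends on.
      rw [Finset.sum_comm, ← Fintype.sum_prod_type', ← (Fin.snocEquiv fun _ => Fin A.coins).sum_comp]
      refine Finset.sum_congr rfl fun p _ => ?_
      simp [run, Fin.snocEquiv]
    rw [h]
    calc _ ≤ ∑ m : Fin T → Fin A.coins, r * Φ (A.run s T m) :=
          Finset.sum_le_sum fun m _ => hΦ _ (ih1 m)
      _ = r * ∑ m : Fin T → Fin A.coins, Φ (A.run s T m) := by rw [Finset.mul_sum]
      _ ≤ r * (r ^ T * Φ ⟨A.init, [], fun _ => 0⟩) := by gcongr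
      _ = _ := by ring

end TQMAlgorithm

/-! ### One round: estimation error and weight growth together. -/

namespace ImportWeightMW

/-- The scalar inequalities by which `ρ` bounds the growth per round of both potentials. -/
structure IsGrowthRate (k : ℕ) (lam ρ : ℝ) : Prop where
  upper : ∀ y ∈ Set.Icc (0 : ℝ) 1, tiltBound k lam +
    y * (Real.exp (lam * k) - 1) * (1 + (Real.exp (lam * k / 2) - 1) / k) ≤
      k * ρ * Real.exp (lam * y)
  lower : ∀ y ∈ Set.Icc (0 : ℝ) 1, tiltBound k lam -
    y * (1 - Real.exp (-(lam * k))) * (1 - (1 - Real.exp (-(lam * k / 2))) / (k + 1)) ≤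
      k * ρ * Real.exp (-(lam * y))

section Round

variable {n : ℕ} [NeZero n] {k : ℕ} {w v : Fin n → ℝ}

/-- The response at the lower index `r` vanishes unless `q_r` is the query, so a single draw departs
from the sum of `meanTilt`; the correlation there is controlled by `meanTilt_le`. The resulting
bound carries `exp(λ y_r)`, which `y_r ≤ v i` absorbs. -/
lemma sum_exp_lower_le (hw : ∀ i, 0 < w i) (hm : Monotone v) (hv : ∀ i, v i ∈ Set.Icc (0 : ℝ) 1)
    {lam ρ : ℝ} (hlam : 0 ≤ lam) (hρ : IsGrowthRate k lam ρ) (i : Fin n) :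
    ∑ m : Fin k, Real.exp (lam * (response w v m (lowerIndex k w i) - v i)) * meanTilt lam w v m ≤
      k * ρ := by
  have hS := sum_meanTilt_le (k := k) hw hm hv hlam
  have hl := lowerIndex_le k w i
  have hY := trueAnswer_mem (k := k) (w := w) hv (lowerIndex k w i)
  set y := trueAnswer k w v (lowerIndex k w i) with hy
  have hyv : y ≤ v i := trueAnswer_lowerIndex_le hm hv i
  have hE : 0 ≤ Real.exp (lam * k) - 1 := sub_nonneg.2 (Real.one_le_exp (by positivity))
  have key : ∑ m : Fin k, Real.exp (lam * response w v m (lowerIndex k w i)) * meanTilt lam w v m ≤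
      tiltBound k lam +
        y * (Real.exp (lam * k) - 1) * (1 + (Real.exp (lam * k / 2) - 1) / k) := by
    rcases Nat.eq_zero_or_pos (lowerIndex k w i) with h0 | h0
    · have hy0 : y = 0 := by rw [hy, h0, trueAnswer_zero]
      rw [hy0, zero_mul, zero_mul, add_zero, h0]
      refine le_trans (le_of_eq (Finset.sum_congr rfl fun m _ => ?_)) hS
      rw [response_of_ne (by omega) (by omega), mul_zero, Real.exp_zero, one_mul]
    · obtain ⟨a, ha⟩ := Nat.exists_eq_add_of_le' h0
      have hak : a < k := by omega
      have hpt : ∀ m : Fin k,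
          Real.exp (lam * response w v m (lowerIndex k w i)) * meanTilt lam w v m =
          meanTilt lam w v m + if m = ⟨a, hak⟩ then
            (Real.exp (lam * k * y) - 1) * meanTilt lam w v ⟨a, hak⟩ else 0 := by
        intro m
        split_ifs with h
        · have h2 : response w v m (lowerIndex k w i) = k * y := by
            have := response_self (w := w) (v := v) m
            rw [show (m : ℕ) + 1 = lowerIndex k w i by rw [h, ha]] at this
            exact this
          rw [h2, h]
          ring_nf
        · rw [response_of_ne (by omega), mul_zero, Real.exp_zero, one_mul, add_zero]
          intro h2
          exact h (Fin.ext (by simp; omega))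
      simp_rw [hpt]
      rw [Finset.sum_add_distrib, Finset.sum_ite_eq' Finset.univ, if_pos (Finset.mem_univ _)]
      have h3 := meanTilt_le (lam := lam) hw hv hlam ⟨a, hak⟩ i ha.symm
      have h4 := Real.exp_mul_le_chord (x := lam * k) hY.1 hY.2
      have h5 : 1 ≤ Real.exp (lam * k * y) := Real.one_le_exp (by have := hY.1; positivity)
      have h6 : (Real.exp (lam * k * y) - 1) * meanTilt lam w v ⟨a, hak⟩ ≤
          (Real.exp (lam * k * y) - 1) * (1 + (Real.exp (lam * k / 2) - 1) / k) := by
        gcongr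
      have h7 : (Real.exp (lam * k * y) - 1) * (1 + (Real.exp (lam * k / 2) - 1) / k) ≤
          y * (Real.exp (lam * k) - 1) * (1 + (Real.exp (lam * k / 2) - 1) / k) := by
        have : 1 ≤ Real.exp (lam * k / 2) := Real.one_le_exp (by positivity)
        have : 0 ≤ (Real.exp (lam * k / 2) - 1) / k := div_nonneg (by linarith) (by positivity)
        gcongr
        linarith
      linarith
  calc _ = Real.exp (-(lam * v i)) * ∑ m : Fin k,
        Real.exp (lam * response w v m (lowerIndex k w i)) * meanTilt lam w v m := by
        rw [Finset.mul_sum]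
        refine Finset.sum_congr rfl fun m _ => ?_
        rw [← mul_assoc, ← Real.exp_add]
        ring_nf
    _ ≤ Real.exp (-(lam * v i)) * (k * ρ * Real.exp (lam * y)) := by
        gcongr
        exact key.trans (hρ.upper y hY)
    _ = k * ρ * Real.exp (lam * (y - v i)) := by
        rw [mul_left_comm, ← Real.exp_add]
        ring_nf
    _ ≤ k * ρ * 1 := by
        have h8 := hρ.upper 0 (by simp)
        have h9 : 0 ≤ tiltBound k lam := by
          refine le_trans (Finset.sum_nonneg fun m _ => ?_) hS
          exact Finset.sum_nonneg fun j _ => mul_nonneg (normalized_pos hw j).le (tilt_pos _ _ _).le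
        simp only [zero_mul, add_zero, mul_zero, Real.exp_zero, mul_one] at h8
        have h10 : 0 ≤ k * ρ := h9.trans h8
        gcongr
        rw [Real.exp_le_one_iff]
        exact mul_nonpos_of_nonneg_of_nonpos hlam (by linarith)
    _ = _ := mul_one _

/-- As for the lower index, with signs reversed: the one exceptional draw now reduces the sum, so
`meanTilt` is needed from below. At the index `k + 1` the answer 1 dominates `v i` in every draw. -/
lemma sum_exp_upper_le (hw : ∀ i, 0 < w i) (hm : Monotone v) (hv : ∀ i, v i ∈ Set.Icc (0 : ℝ) 1)
    {lam ρ : ℝ} (hlam : 0 ≤ lam) (hρ : IsGrowthRate k lam ρ) (i : Fin n) :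
    ∑ m : Fin k, Real.exp (lam * (v i - response w v m (upperIndex k w i))) * meanTilt lam w v m ≤
      k * ρ := by
  have hS := sum_meanTilt_le (k := k) hw hm hv hlam
  have hY := trueAnswer_mem (k := k) (w := w) hv (upperIndex k w i)
  have hnn : ∀ m : Fin k, 0 ≤ meanTilt lam w v m := fun m =>
    Finset.sum_nonneg fun j _ => mul_nonneg (normalized_pos hw j).le (tilt_pos _ _ _).le
  have h9 : 0 ≤ tiltBound k lam := (Finset.sum_nonneg fun m _ => hnn m).trans hS
  have h8 := hρ.lower 0 (by simp)
  simp only [zero_mul, sub_zero, mul_zero, neg_zero, Real.exp_zero, mul_one] at h8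
  rcases (upperIndex_mem k w i).1.lt_or_eq with hu | hu
  · set y := trueAnswer k w v (upperIndex k w i) with hy
    have hyv : v i ≤ y := le_trueAnswer_upperIndex hm hv i
    have key : ∑ m : Fin k,
        Real.exp (-(lam * response w v m (upperIndex k w i))) * meanTilt lam w v m ≤
        tiltBound k lam - y * (1 - Real.exp (-(lam * k))) *
          (1 - (1 - Real.exp (-(lam * k / 2))) / (k + 1)) := by
      obtain ⟨a, ha⟩ := Nat.exists_eq_add_of_le' (one_le_upperIndex k w i)
      have hak : a < k := by omega
      have hpt : ∀ m : Fin k,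
          Real.exp (-(lam * response w v m (upperIndex k w i))) * meanTilt lam w v m =
          meanTilt lam w v m + if m = ⟨a, hak⟩ then
            (Real.exp (-(lam * k) * y) - 1) * meanTilt lam w v ⟨a, hak⟩ else 0 := by
        intro m
        split_ifs with h
        · have h2 : response w v m (upperIndex k w i) = k * y := by
            have := response_self (w := w) (v := v) m
            rw [show (m : ℕ) + 1 = upperIndex k w i by rw [h, ha]] at this
            exact this
          rw [h2, h]
          ring_nf
        · rw [response_of_ne (by omega), mul_zero, neg_zero, Real.exp_zero, one_mul, add_zero]
          intro h2
          exact h (Fin.ext (by simp; omega))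
      simp_rw [hpt]
      rw [Finset.sum_add_distrib, Finset.sum_ite_eq' Finset.univ, if_pos (Finset.mem_univ _)]
      have h3 := le_meanTilt (lam := lam) hw hv hlam ⟨a, hak⟩ i ha.symm
      have h4 := Real.exp_mul_le_chord (x := -(lam * k)) hY.1 hY.2
      have h5 : Real.exp (-(lam * k)) ≤ 1 := by
        rw [Real.exp_le_one_iff]
        have : 0 ≤ lam * k := by positivity
        linarith
      have h6 : y * (1 - Real.exp (-(lam * k))) *
          (1 - (1 - Real.exp (-(lam * k / 2))) / (k + 1)) ≤
          y * (1 - Real.exp (-(lam * k))) * meanTilt lam w v ⟨a, hak⟩ := by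
        have := hY.1
        have : 0 ≤ 1 - Real.exp (-(lam * k)) := by linarith
        gcongr
      have h7 : y * (1 - Real.exp (-(lam * k))) * meanTilt lam w v ⟨a, hak⟩ ≤
          (1 - Real.exp (-(lam * k) * y)) * meanTilt lam w v ⟨a, hak⟩ := by
        have := hnn ⟨a, hak⟩
        gcongr
        linarith
      linarith
    calc _ = Real.exp (lam * v i) * ∑ m : Fin k,
          Real.exp (-(lam * response w v m (upperIndex k w i))) * meanTilt lam w v m := by
          rw [Finset.mul_sum]
          refine Finset.sum_congr rfl fun m _ => ?_
          rw [← mul_assoc, ← Real.exp_add]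
          ring_nf
      _ ≤ Real.exp (lam * v i) * (k * ρ * Real.exp (-(lam * y))) := by
          gcongr
          exact key.trans (hρ.lower y hY)
      _ = k * ρ * Real.exp (lam * (v i - y)) := by
          rw [mul_left_comm, ← Real.exp_add]
          ring_nf
      _ ≤ k * ρ * 1 := by
          have h10 : 0 ≤ k * ρ := h9.trans h8
          gcongr
          rw [Real.exp_le_one_iff]
          exact mul_nonpos_of_nonneg_of_nonpos hlam (by linarith)
      _ = _ := mul_one _
  · refine le_trans (Finset.sum_le_sum fun m _ => ?_) (hS.trans h8)
    rw [hu, response_last]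
    refine mul_le_of_le_one_left (hnn m) ?_
    rw [Real.exp_le_one_iff]
    exact mul_nonpos_of_nonneg_of_nonpos hlam (by linarith [(hv i).2])

end Round

/-! ### The potentials and their growth per round. -/

section Potential

variable {n : ℕ} [NeZero n] {k : ℕ} {η : ℝ}

/-- The weights in a configuration. -/
def weights (c : (importWeightMW n k η).Config) : Fin n → ℝ :=
  (show State n from c.state).weight

/-- The accumulated estimates in a configuration. -/
def sums (c : (importWeightMW n k η).Config) : Fin n → ℝ :=
  (show State n from c.state).sum

/-- The relative weight `W / w_i` in a configuration. -/
def weightRatio (c : (importWeightMW n k η).Config) (i : Fin n) : ℝ :=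
  (∑ j, weights c j) / weights c i

lemma one_le_weightRatio {c : (importWeightMW n k η).Config} (hc : ∀ j, 0 < weights c j)
    (i : Fin n) : 1 ≤ weightRatio c i := by
  rw [weightRatio, one_le_div (hc i)]
  exact Finset.single_le_sum (fun j _ => (hc j).le) (Finset.mem_univ i)

variable (s : List (Fin n) → Fin n → ℝ)

lemma weights_step (c : (importWeightMW n k η).Config) (m : Fin k) (j : Fin n) :
    weights ((importWeightMW n k η).step s c m) j = weights c j * (1 + η) ^
      (response (weights c) (s c.history) m (upperIndex k (weights c) j) -
        response (weights c) (s c.history) m (lowerIndex k (weights c) j)) := rfl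

lemma sums_step (c : (importWeightMW n k η).Config) (m : Fin k) (j : Fin n) :
    sums ((importWeightMW n k η).step s c m) j = sums c j +
      (response (weights c) (s c.history) m (lowerIndex k (weights c) j) +
        response (weights c) (s c.history) m (upperIndex k (weights c) j)) := rfl

lemma total_step (c : (importWeightMW n k η).Config) (m : Fin k) (j : Fin n) :
    ((importWeightMW n k η).step s c m).total j = c.total j + s c.history j := rfl

lemma weights_step_pos (hη : 0 ≤ η) {c : (importWeightMW n k η).Config}
    (hc : ∀ j, 0 < weights c j) (m : Fin k) (j : Fin n) :
    0 < weights ((importWeightMW n k η).step s c m) j := by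
  rw [weights_step]
  exact mul_pos (hc j) (Real.rpow_pos_of_pos (by linarith) _)

/-- The total weight grows by a mean of the powers `(1+η)^d`, and Jensen for the power `κ ≥ 1` moves
the exponent inside, where `(1+η)^(κd) = exp(λd/2)`. The weight of `i` itself contributes the last
factor exactly. -/
lemma weightRatio_step_rpow_le (hη : 0 ≤ η) {c : (importWeightMW n k η).Config}
    (hc : ∀ j, 0 < weights c j) (m : Fin k) (i : Fin n) {κ lam : ℝ} (hκ : 1 ≤ κ)
    (hlam : κ * Real.log (1 + η) = lam / 2) :
    weightRatio ((importWeightMW n k η).step s c m) i ^ κ ≤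
      weightRatio c i ^ κ * meanTilt lam (weights c) (s c.history) m *
        Real.exp (-(lam / 2 *
          (response (weights c) (s c.history) m (upperIndex k (weights c) i) -
            response (weights c) (s c.history) m (lowerIndex k (weights c) i)))) := by
  have hb : 0 < 1 + η := by linarith
  set d : Fin n → ℝ := fun j =>
    response (weights c) (s c.history) m (upperIndex k (weights c) j) -
      response (weights c) (s c.history) m (lowerIndex k (weights c) j) with hd
  have hW := sum_pos_of_weight_pos hc
  have hpow : ∀ j, ((1 + η) ^ d j) ^ κ = Real.exp (lam / 2 * d j) := by
    intro j
    rw [← Real.rpow_mul hb.le, Real.rpow_def_of_pos hb, ← hlam]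
    ring_nf
  have hA : 0 ≤ ∑ j, normalized (weights c) j * (1 + η) ^ d j :=
    Finset.sum_nonneg fun j _ => mul_nonneg (normalized_pos hc j).le (Real.rpow_nonneg hb.le _)
  have hratio : weightRatio ((importWeightMW n k η).step s c m) i =
      weightRatio c i * (∑ j, normalized (weights c) j * (1 + η) ^ d j) *
        ((1 + η) ^ d i)⁻¹ := by
    have h1 : ∑ j, normalized (weights c) j * (1 + η) ^ d j =
        (∑ j, weights c j * (1 + η) ^ d j) / ∑ j, weights c j := by
      rw [Finset.sum_div]
      exact Finset.sum_congr rfl fun j _ => by rw [normalized]; ring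
    rw [h1, weightRatio, weightRatio]
    simp_rw [weights_step]
    have := (hc i).ne'
    have := (Real.rpow_pos_of_pos hb (d i)).ne'
    change _ / (weights c i * (1 + η) ^ d i) = _
    field_simp
    rfl
  have hjensen : (∑ j, normalized (weights c) j * (1 + η) ^ d j) ^ κ ≤
      meanTilt lam (weights c) (s c.history) m := by
    refine (Real.rpow_arith_mean_le_arith_mean_rpow Finset.univ _ _
      (fun j _ => (normalized_pos hc j).le) (sum_normalized hc)
      (fun j _ => Real.rpow_nonneg hb.le _) hκ).trans (le_of_eq ?_)
    exact Finset.sum_congr rfl fun j _ => by rw [hpow j]; rfl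
  have hR : 0 ≤ weightRatio c i := zero_le_one.trans (one_le_weightRatio hc i)
  rw [hratio, Real.mul_rpow (mul_nonneg hR hA) (inv_nonneg.2 (Real.rpow_nonneg hb.le _)),
    Real.mul_rpow hR hA, Real.inv_rpow (Real.rpow_nonneg hb.le _), hpow i, ← Real.exp_neg]
  gcongr

variable {s} in
lemma sum_upper_potential_step_le (hm : ∀ h, Monotone (s h))
    (hv : ∀ h i, s h i ∈ Set.Icc (0 : ℝ) 1) (hη : 0 ≤ η) {κ lam ρ : ℝ} (hκ : 1 ≤ κ)
    (hlam : κ * Real.log (1 + η) = lam / 2) (hlam0 : 0 ≤ lam) (hρ : IsGrowthRate k lam ρ)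
    (i : Fin n) {c : (importWeightMW n k η).Config} (hc : ∀ j, 0 < weights c j) :
    ∑ m : Fin k, Real.exp (lam * (sums ((importWeightMW n k η).step s c m) i / 2 -
        ((importWeightMW n k η).step s c m).total i)) *
        weightRatio ((importWeightMW n k η).step s c m) i ^ κ ≤
      k * ρ * (Real.exp (lam * (sums c i / 2 - c.total i)) * weightRatio c i ^ κ) := by
  have hR : 0 ≤ weightRatio c i := zero_le_one.trans (one_le_weightRatio hc i)
  have hstep := sum_exp_lower_le (k := k) hc (hm c.history) (hv c.history) hlam0 hρ i
  calc _ ≤ ∑ m : Fin k, (Real.exp (lam * (response (weights c) (s c.history) m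
          (lowerIndex k (weights c) i) - s c.history i)) * meanTilt lam (weights c) (s c.history) m)
          * (Real.exp (lam * (sums c i / 2 - c.total i)) * weightRatio c i ^ κ) := by
        refine Finset.sum_le_sum fun m _ => ?_
        refine (mul_le_mul_of_nonneg_left (weightRatio_step_rpow_le s hη hc m i hκ hlam)
          (Real.exp_pos _).le).trans (le_of_eq ?_)
        rw [sums_step, total_step]
        generalize response (weights c) (s c.history) m (lowerIndex k (weights c) i) = a
        generalize response (weights c) (s c.history) m (upperIndex k (weights c) i) = b
        -- The midpoint `(a + b)/2` and the weight factor `(b - a)/2` combine to `a`: only the lower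
        -- estimate remains.
        have h : Real.exp (lam * ((sums c i + (a + b)) / 2 - (c.total i + s c.history i))) *
            Real.exp (-(lam / 2 * (b - a))) =
            Real.exp (lam * (a - s c.history i)) * Real.exp (lam * (sums c i / 2 - c.total i)) := by
          rw [← Real.exp_add, ← Real.exp_add]
          ring_nf
        linear_combination (weightRatio c i ^ κ * meanTilt lam (weights c) (s c.history) m) * h
    _ ≤ _ := by
        rw [← Finset.sum_mul]
        gcongr

variable {s} in
lemma sum_lower_potential_step_le (hm : ∀ h, Monotone (s h))
    (hv : ∀ h i, s h i ∈ Set.Icc (0 : ℝ) 1) (hη : 0 ≤ η) {κ lam ρ : ℝ} (hκ : 1 ≤ κ)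
    (hlam : κ * Real.log (1 + η) = lam / 2) (hlam0 : 0 ≤ lam) (hρ : IsGrowthRate k lam ρ)
    (i : Fin n) {c : (importWeightMW n k η).Config} (hc : ∀ j, 0 < weights c j) :
    ∑ m : Fin k, Real.exp (lam * (((importWeightMW n k η).step s c m).total i -
        sums ((importWeightMW n k η).step s c m) i / 2)) *
        weightRatio ((importWeightMW n k η).step s c m) i ^ κ ≤
      k * ρ * (Real.exp (lam * (c.total i - sums c i / 2)) * weightRatio c i ^ κ) := by
  have hR : 0 ≤ weightRatio c i := zero_le_one.trans (one_le_weightRatio hc i)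
  have hstep := sum_exp_upper_le (k := k) hc (hm c.history) (hv c.history) hlam0 hρ i
  calc _ ≤ ∑ m : Fin k, (Real.exp (lam * (s c.history i - response (weights c) (s c.history) m
          (upperIndex k (weights c) i))) * meanTilt lam (weights c) (s c.history) m)
          * (Real.exp (lam * (c.total i - sums c i / 2)) * weightRatio c i ^ κ) := by
        refine Finset.sum_le_sum fun m _ => ?_
        refine (mul_le_mul_of_nonneg_left (weightRatio_step_rpow_le s hη hc m i hκ hlam)
          (Real.exp_pos _).le).trans (le_of_eq ?_)
        rw [sums_step, total_step]
        generalize response (weights c) (s c.history) m (lowerIndex k (weights c) i) = a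
        generalize response (weights c) (s c.history) m (upperIndex k (weights c) i) = b
        -- With the opposite sign, `-(a + b)/2 - (b - a)/2 = -b`: only the upper estimate remains.
        have h : Real.exp (lam * (c.total i + s c.history i - (sums c i + (a + b)) / 2)) *
            Real.exp (-(lam / 2 * (b - a))) =
            Real.exp (lam * (s c.history i - b)) * Real.exp (lam * (c.total i - sums c i / 2)) := by
          rw [← Real.exp_add, ← Real.exp_add]
          ring_nf
        linear_combination (weightRatio c i ^ κ * meanTilt lam (weights c) (s c.history) m) * h
    _ ≤ _ := by
        rw [← Finset.sum_mul]
        gcongr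

/-- The number of draws for which the deviation `±(∑ (ℓ̂ + û) / 2 - ∑ v)` at `i` exceeds `x`. -/
lemma card_deviation_le {Φ : (importWeightMW n k η).Config → ℝ} {κ lam ρ x : ℝ} (hη : 0 ≤ η)
    (hκ : 0 ≤ κ) (hρ : 0 ≤ ρ) (hlam : 0 < lam) (i : Fin n)
    (h0 : Φ ⟨(importWeightMW n k η).init, [], fun _ => 0⟩ = 0)
    (hstep : ∀ c, (∀ j, 0 < weights c j) →
      ∑ m : Fin k, Real.exp (lam * Φ ((importWeightMW n k η).step s c m)) *
        weightRatio ((importWeightMW n k η).step s c m) i ^ κ ≤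
      k * ρ * (Real.exp (lam * Φ c) * weightRatio c i ^ κ)) (T : ℕ) :
    ((Finset.univ.filter fun m : Fin T → Fin k =>
      x < Φ ((importWeightMW n k η).run s T m)).card : ℝ) * Real.exp (lam * x) ≤
      (k * ρ) ^ T * (n : ℝ) ^ κ := by
  obtain ⟨h1, h2⟩ := (importWeightMW n k η).sum_potential_run_le s
    (I := fun c => ∀ j, 0 < weights c j)
    (Φ := fun c => Real.exp (lam * Φ c) * weightRatio c i ^ κ) (r := k * ρ) (by positivity)
    (fun j => by
      have : (0 : ℝ) < n := by exact_mod_cast Nat.pos_of_neZero n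
      exact one_div_pos.2 this)
    (fun c m hc j => weights_step_pos s hη hc m j) hstep T
  have hinit : weightRatio ⟨(importWeightMW n k η).init, [], fun _ => 0⟩ i = (n : ℝ) := by
    have hn : (n : ℝ) ≠ 0 := by exact_mod_cast NeZero.ne n
    change (∑ _j : Fin n, (1 : ℝ) / n) / (1 / n) = n
    simp [hn]
  rw [h0, hinit, mul_zero, Real.exp_zero, one_mul] at h2
  refine le_trans ?_ h2
  rw [← nsmul_eq_mul, ← Finset.sum_const]
  -- Markov's inequality in counting form; the factor `(W/w_i)^κ ≥ 1` is dropped on the bad draws.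
  refine le_trans (Finset.sum_le_sum fun m hm => ?_)
    (Finset.sum_le_sum_of_subset_of_nonneg (Finset.filter_subset _ _) fun m _ _ => ?_)
  · have h3 := (Finset.mem_filter.1 hm).2
    calc Real.exp (lam * x) ≤ Real.exp (lam * Φ ((importWeightMW n k η).run s T m)) * 1 := by
          rw [mul_one]; gcongr
      _ ≤ _ := by
          gcongr
          exact Real.one_le_rpow (one_le_weightRatio (h1 m) i) hκ
  · exact mul_nonneg (Real.exp_pos _).le
      (Real.rpow_nonneg (zero_le_one.trans (one_le_weightRatio (h1 m) i)) _)

end Potential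

end ImportWeightMW

/-! ### Taylor bounds for exponential and hyperbolic functions on `[0, 1]`. -/

section ExpBounds

variable {x : ℝ}

/-- The remainder after five terms is at most `6/(5!·5) x⁵ = x⁵/100`; after four terms, as used
below, it is at most `5/(4!·4) x⁴ = 5x⁴/96`. -/
lemma Real.exp_le_quintic (h0 : 0 ≤ x) (h1 : x ≤ 1) :
    Real.exp x ≤ 1 + x + x ^ 2 / 2 + x ^ 3 / 6 + x ^ 4 / 24 + x ^ 5 / 100 := by
  have h := Real.exp_bound' h0 h1 (n := 5) (by norm_num)
  norm_num [Finset.sum_range_succ, Nat.factorial] at h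
  linarith

lemma Real.exp_le_quartic (h0 : 0 ≤ x) (h1 : x ≤ 1) :
    Real.exp x ≤ 1 + x + x ^ 2 / 2 + x ^ 3 / 6 + 5 * x ^ 4 / 96 := by
  have h := Real.exp_bound' h0 h1 (n := 4) (by norm_num)
  norm_num [Finset.sum_range_succ, Nat.factorial] at h
  linarith

lemma Real.exp_neg_le_quintic (h0 : 0 ≤ x) (h1 : x ≤ 1) :
    Real.exp (-x) ≤ 1 - x + x ^ 2 / 2 - x ^ 3 / 6 + x ^ 4 / 24 + x ^ 5 / 100 := by
  have h := (abs_le.1 (Real.exp_bound (x := -x) (by rwa [abs_neg, abs_of_nonneg h0])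
    (n := 5) (by norm_num))).2
  rw [abs_neg, abs_of_nonneg h0] at h
  norm_num [Finset.sum_range_succ, Nat.factorial] at h
  linarith

lemma Real.abs_exp_neg_sub_quartic_le (h0 : 0 ≤ x) (h1 : x ≤ 1) :
    |Real.exp (-x) - (1 - x + x ^ 2 / 2 - x ^ 3 / 6)| ≤ 5 * x ^ 4 / 96 := by
  have h := Real.exp_bound (x := -x) (by rwa [abs_neg, abs_of_nonneg h0])
    (n := 4) (by norm_num)
  rw [abs_neg, abs_of_nonneg h0] at h
  norm_num [Finset.sum_range_succ, Nat.factorial] at h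
  rw [abs_le] at h ⊢
  constructor <;> linarith [h.1, h.2]

lemma Real.cubic_le_exp_neg (h0 : 0 ≤ x) (h1 : x ≤ 1) :
    1 - x + x ^ 2 / 2 - x ^ 3 / 6 ≤ Real.exp (-x) := by
  have h := (abs_le.1 (Real.exp_bound (x := -x) (by rwa [abs_neg, abs_of_nonneg h0])
    (n := 5) (by norm_num))).1
  rw [abs_neg, abs_of_nonneg h0] at h
  norm_num [Finset.sum_range_succ, Nat.factorial] at h
  have h5 : x ^ 5 ≤ x ^ 4 := pow_le_pow_of_le_one h0 h1 (by norm_num)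
  have h4 : 0 ≤ x ^ 4 := by positivity
  linarith

lemma Real.sinh_le_quartic (h0 : 0 ≤ x) (h1 : x ≤ 1) :
    Real.sinh x ≤ x * (1 + x ^ 2 / 6 + 5 * x ^ 3 / 96) := by
  have ha := Real.exp_le_quartic h0 h1
  have hb := (abs_le.1 (Real.abs_exp_neg_sub_quartic_le h0 h1)).1
  rw [Real.sinh_eq]
  linarith

lemma Real.cosh_le_quartic (h0 : 0 ≤ x) (h1 : x ≤ 1) :
    2 * Real.cosh x - 2 ≤ x * (x + 5 * x ^ 3 / 48) := by
  have ha := Real.exp_le_quartic h0 h1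
  have hb := (abs_le.1 (Real.abs_exp_neg_sub_quartic_le h0 h1)).2
  rw [Real.cosh_eq]
  linarith

end ExpBounds

namespace ImportWeightMW

/-! ### Polynomial inequalities behind the growth rate. -/

section Scalar

/-- The endpoint `y = 1` of `IsGrowthRate.upper`, after Taylor expansion and division by `2w = λk`.
Here `p` stands for `1/(k+1)`, `w` for `λk/2`, and `W` is the value of `w` at `kε = 2 + ε`. -/
lemma upper_rate_polynomial {ε p w W : ℝ} (h0 : 0 < ε) (h1 : ε ≤ 1) (hw0 : 0 ≤ w)
    (hW : W = 3 / 32 * ε * (2 + ε)) (hwW : w ≤ W) (hp : p ≤ ε / 2)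
    (hpw : p / 2 ≤ ε / (4 * (1 + ε)) + (W - w) * (4 / 3 - 2 / 3 * ε)) :
    p / 2 * (1 + w ^ 2 / 6 + 5 * w ^ 3 / 96) + (w + 5 * w ^ 3 / 48) / 2 +
      (1 + w + 2 / 3 * w ^ 2 + w ^ 3 / 3 + 4 / 25 * w ^ 4) *
        (1 + 3 / 32 * ε ^ 2 * (1 + w / 2 + w ^ 2 / 6 + 5 * w ^ 3 / 96)) ≤
    1 + (13 / 24 * ε - ε ^ 3 / 256) +
      3 / 32 * ε ^ 2 * (1 + (13 / 24 * ε - ε ^ 3 / 256)) ^ 2 := by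
  have hW0 : 0 ≤ W := hw0.trans hwW
  have hrest : ε / 2 / 2 * (w ^ 2 / 6 + 5 * w ^ 3 / 96) + (5 * w ^ 3 / 48) / 2 +
      (2 / 3 * w ^ 2 + w ^ 3 / 3 + 4 / 25 * w ^ 4) +
      (1 + w + 2 / 3 * w ^ 2 + w ^ 3 / 3 + 4 / 25 * w ^ 4) *
        (3 / 32 * ε ^ 2 * (1 + w / 2 + w ^ 2 / 6 + 5 * w ^ 3 / 96)) ≤
      ε / 2 / 2 * (W ^ 2 / 6 + 5 * W ^ 3 / 96) + (5 * W ^ 3 / 48) / 2 +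
      (2 / 3 * W ^ 2 + W ^ 3 / 3 + 4 / 25 * W ^ 4) +
      (1 + W + 2 / 3 * W ^ 2 + W ^ 3 / 3 + 4 / 25 * W ^ 4) *
        (3 / 32 * ε ^ 2 * (1 + W / 2 + W ^ 2 / 6 + 5 * W ^ 3 / 96)) := by gcongr
  have hpc : p / 2 * (w ^ 2 / 6 + 5 * w ^ 3 / 96) ≤ ε / 2 / 2 * (w ^ 2 / 6 + 5 * w ^ 3 / 96) := by
    gcongr
  -- A smaller `k` increases `p` but decreases `w`. The gain in `w` prevails because `4/3 - 2ε/3 ≤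
  -- 3/2`, so the worst case is `w = W`.
  have hlin : p / 2 + 3 / 2 * w ≤ ε / (4 * (1 + ε)) + 3 / 2 * W := by
    nlinarith [mul_nonneg (sub_nonneg.2 hwW) h0.le]
  have hfin : ε / (4 * (1 + ε)) + 3 / 2 * W +
      (ε / 2 / 2 * (W ^ 2 / 6 + 5 * W ^ 3 / 96) + (5 * W ^ 3 / 48) / 2 +
      (2 / 3 * W ^ 2 + W ^ 3 / 3 + 4 / 25 * W ^ 4) +
      (1 + W + 2 / 3 * W ^ 2 + W ^ 3 / 3 + 4 / 25 * W ^ 4) *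
        (3 / 32 * ε ^ 2 * (1 + W / 2 + W ^ 2 / 6 + 5 * W ^ 3 / 96))) ≤
      (13 / 24 * ε - ε ^ 3 / 256) +
      3 / 32 * ε ^ 2 * (1 + (13 / 24 * ε - ε ^ 3 / 256)) ^ 2 := by
    have hc : ε / (4 * (1 + ε)) * (1 + ε) = ε / 4 := by field_simp
    refine le_of_mul_le_mul_right ?_ (by linarith : 0 < 1 + ε)
    rw [add_mul, add_mul, hc, hW]
    -- With denominators cleared, this is an inequality between polynomials in `ε` of degree at most
    -- 17 on `[0, 1]`; these nonnegative polynomials supply a linear certificate.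
    have hb : ∀ i : ℕ, 0 ≤ ε ^ i * (1 - ε) := fun i =>
      mul_nonneg (by positivity) (by linarith)
    have hb2 : ∀ i : ℕ, 0 ≤ ε ^ i * (1 - ε) ^ 2 := fun i => by positivity
    have hb3 : ∀ i : ℕ, 0 ≤ ε ^ i := fun i => by positivity
    linarith [hb 1, hb 2, hb 3, hb 4, hb 5, hb 6, hb 7, hb 8, hb 9, hb 10, hb 11, hb 12, hb 13,
      hb 14, hb 15, hb 16, hb2 1, hb2 2, hb2 3, hb3 17]
  linarith

/-- The endpoint `y = 1` of `IsGrowthRate.lower`, normalized in the same way; `ν` bounds the loss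
`(1 - e⁻ʷ)/(k+1)` from `le_meanTilt`. -/
lemma lower_rate_polynomial {ε p w W ν : ℝ} (h0 : 0 < ε) (h1 : ε ≤ 1) (hw0 : 0 ≤ w)
    (hW : W = 3 / 32 * ε * (2 + ε)) (hwW : w ≤ W) (hp : p ≤ ε / 2)
    (hpw : p / 2 ≤ ε / (4 * (1 + ε)) + (W - w) * (4 / 3 - 2 / 3 * ε))
    (hν : ν = 3 / 32 * ε ^ 2 * ((2 + ε) / (2 + 2 * ε)) * (1 - W / 2 + W ^ 2 / 6)) :
    p / 2 * (1 + w ^ 2 / 6 + 5 * w ^ 3 / 96) + (w + 5 * w ^ 3 / 48) / 2 -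
      (1 - w + 2 / 3 * w ^ 2 - w ^ 3 / 3 - 4 / 25 * w ^ 4) * (1 - ν) ≤
    -(1 - (13 / 24 * ε - ε ^ 3 / 256)) +
      3 / 32 * ε ^ 2 * (1 - (13 / 24 * ε - ε ^ 3 / 256)) ^ 2 -
      (3 / 16 * ε ^ 2) ^ 2 / 6 * (1 - (13 / 24 * ε - ε ^ 3 / 256)) ^ 3 := by
  have hW0 : 0 ≤ W := hw0.trans hwW
  have hW1 : W ≤ 3 / 16 * ε + 3 / 32 * ε ^ 2 := by rw [hW]; linarith
  have hε2 : ε ^ 2 ≤ ε := by nlinarith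
  have hW2 : W ≤ 9 / 32 := by linarith
  have hν1 : ν ≤ 3 / 32 * ε ^ 2 := by
    have hr : (2 + ε) / (2 + 2 * ε) ≤ 1 := by rw [div_le_one (by linarith)]; linarith
    have hr0 : 0 ≤ (2 + ε) / (2 + 2 * ε) := by positivity
    have hs : 1 - W / 2 + W ^ 2 / 6 ≤ 1 := by nlinarith
    have hs0 : 0 ≤ 1 - W / 2 + W ^ 2 / 6 := by nlinarith
    rw [hν]
    calc _ ≤ 3 / 32 * ε ^ 2 * 1 * 1 := by gcongr
      _ = _ := by ring
  have hD : (W - w) * (1 - 4 / 3 * W) + (1 - W + 2 / 3 * W ^ 2 - W ^ 3 / 3 - 4 / 25 * W ^ 4) ≤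
      1 - w + 2 / 3 * w ^ 2 - w ^ 3 / 3 - 4 / 25 * w ^ 4 := by
    have e3 : w ^ 3 ≤ W ^ 3 := by gcongr
    have e4 : w ^ 4 ≤ W ^ 4 := by gcongr
    nlinarith [sq_nonneg (W - w)]
  have hDν := mul_le_mul_of_nonneg_right hD (by linarith : 0 ≤ 1 - ν)
  -- As `w` falls below `W`, the bound on `p/2` rises no faster than the other terms fall, so again
  -- `w = W` is the worst case.
  have hcoef : 4 / 3 - 2 / 3 * ε ≤ 1 / 2 + (1 - 4 / 3 * W) * (1 - ν) := by
    nlinarith [mul_nonneg hW0 (by linarith : 0 ≤ 1 - ν)]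
  have hgap := mul_le_mul_of_nonneg_left hcoef (sub_nonneg.2 hwW)
  have hrest : ε / 2 / 2 * (w ^ 2 / 6 + 5 * w ^ 3 / 96) + (5 * w ^ 3 / 48) / 2 ≤
      ε / 2 / 2 * (W ^ 2 / 6 + 5 * W ^ 3 / 96) + (5 * W ^ 3 / 48) / 2 := by gcongr
  have hpc : p / 2 * (w ^ 2 / 6 + 5 * w ^ 3 / 96) ≤ ε / 2 / 2 * (w ^ 2 / 6 + 5 * w ^ 3 / 96) := by
    gcongr
  have hfin : ε / (4 * (1 + ε)) + W / 2 +
      (ε / 2 / 2 * (W ^ 2 / 6 + 5 * W ^ 3 / 96) + (5 * W ^ 3 / 48) / 2) -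
      (1 - W + 2 / 3 * W ^ 2 - W ^ 3 / 3 - 4 / 25 * W ^ 4) * (1 - ν) ≤
      -(1 - (13 / 24 * ε - ε ^ 3 / 256)) +
      3 / 32 * ε ^ 2 * (1 - (13 / 24 * ε - ε ^ 3 / 256)) ^ 2 -
      (3 / 16 * ε ^ 2) ^ 2 / 6 * (1 - (13 / 24 * ε - ε ^ 3 / 256)) ^ 3 := by
    have hc : ε / (4 * (1 + ε)) * (1 + ε) = ε / 4 := by field_simp
    have hνc : ν * (1 + ε) = 3 / 64 * ε ^ 2 * (2 + ε) * (1 - W / 2 + W ^ 2 / 6) := by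
      rw [hν]; field_simp; ring
    refine le_of_mul_le_mul_right ?_ (by linarith : 0 < 1 + ε)
    have hsplit : (ε / (4 * (1 + ε)) + W / 2 +
      (ε / 2 / 2 * (W ^ 2 / 6 + 5 * W ^ 3 / 96) + (5 * W ^ 3 / 48) / 2) -
      (1 - W + 2 / 3 * W ^ 2 - W ^ 3 / 3 - 4 / 25 * W ^ 4) * (1 - ν)) * (1 + ε) =
      ε / 4 + (W / 2 +
      (ε / 2 / 2 * (W ^ 2 / 6 + 5 * W ^ 3 / 96) + (5 * W ^ 3 / 48) / 2)) * (1 + ε) -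
      (1 - W + 2 / 3 * W ^ 2 - W ^ 3 / 3 - 4 / 25 * W ^ 4) *
      (1 + ε - 3 / 64 * ε ^ 2 * (2 + ε) * (1 - W / 2 + W ^ 2 / 6)) := by
      linear_combination hc +
        (1 - W + 2 / 3 * W ^ 2 - W ^ 3 / 3 - 4 / 25 * W ^ 4) * hνc
    rw [hsplit, hW]
    have hb : ∀ i : ℕ, 0 ≤ ε ^ i * (1 - ε) := fun i =>
      mul_nonneg (by positivity) (by linarith)
    have hb2 : ∀ i : ℕ, 0 ≤ ε ^ i * (1 - ε) ^ 2 := fun i => by positivity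
    have hb3 : ∀ i : ℕ, 0 ≤ ε ^ i := fun i => by positivity
    linarith [hb 1, hb 2, hb 3, hb 4, hb 5, hb 6, hb 7, hb 8, hb 9, hb 10, hb 11, hb 12, hb 13,
      hb 14, hb 15, hb 16, hb2 1, hb2 2, hb2 3, hb3 17]
  linarith

/-- The endpoint `y = 0`, with slack of order `λ`. The factor `9/8` is an upper bound for `1 + λθ`.
-/
lemma base_rate_polynomial {ε p w W : ℝ} (h0 : 0 < ε) (h1 : ε ≤ 1) (hw0 : 0 ≤ w)
    (hW : W = 3 / 32 * ε * (2 + ε)) (hwW : w ≤ W) (hp : p ≤ ε / 2) :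
    p / 2 * (1 + w ^ 2 / 6 + 5 * w ^ 3 / 96) + (w + 5 * w ^ 3 / 48) / 2 ≤
    (13 / 24 * ε - ε ^ 3 / 256) - 6 / 10 * (3 / 16 * ε ^ 2) * (9 / 8) := by
  have h : p / 2 * (1 + w ^ 2 / 6 + 5 * w ^ 3 / 96) + (w + 5 * w ^ 3 / 48) / 2 ≤
      ε / 2 / 2 * (1 + W ^ 2 / 6 + 5 * W ^ 3 / 96) + (W + 5 * W ^ 3 / 48) / 2 := by
    gcongr
  refine h.trans ?_
  rw [hW]
  have hb : ∀ i : ℕ, 0 ≤ ε ^ i * (1 - ε) := fun i =>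
    mul_nonneg (by positivity) (by linarith)
  have hb3 : ∀ i : ℕ, 0 ≤ ε ^ i := fun i => by positivity
  linarith [hb 1, hb 2, hb 3, hb 4, hb 5, hb 6, hb3 7]

end Scalar

end ImportWeightMW

namespace ImportWeightMW

/-- A lower bound for the exponential growth rate that the analysis permits, in units of
`λ = 3 ε² / 16`. -/
def rateFactor (ε : ℝ) : ℝ := 13 / 24 * ε - ε ^ 3 / 256

/-! ### Verification of the growth rate. -/

section Rate

variable {ε : ℝ} {k : ℕ}

lemma rateFactor_mem (h0 : 0 < ε) (h1 : ε ≤ 1) : rateFactor ε ∈ Set.Icc 0 (13 / 24 : ℝ) := by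
  have h3 : ε ^ 3 ≤ ε := by
    calc ε ^ 3 ≤ ε ^ 1 := pow_le_pow_of_le_one h0.le h1 (by norm_num)
      _ = ε := pow_one ε
  have h4 : 0 ≤ ε ^ 3 := by positivity
  constructor <;> unfold rateFactor <;> linarith

/-- The quantities `p = 1/(k+1)`, `w = λ k / 2` and the bounds for them in terms of `ε`. -/
lemma rate_parameter_bounds (h0 : 0 < ε) (h1 : ε ≤ 1) (hk2 : 2 ≤ k * ε) (hk : k * ε ≤ 2 + ε) :
    0 ≤ 3 / 16 * ε ^ 2 * k / 2 ∧ 3 / 16 * ε ^ 2 * k / 2 ≤ 3 / 32 * ε * (2 + ε) ∧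
    3 / 32 * ε * (2 + ε) ≤ 9 / 32 ∧ (1 / (k + 1) : ℝ) ≤ ε / 2 ∧
    (1 / (k + 1) : ℝ) / 2 ≤ ε / (4 * (1 + ε)) +
      (3 / 32 * ε * (2 + ε) - 3 / 16 * ε ^ 2 * k / 2) * (4 / 3 - 2 / 3 * ε) := by
  have hp : (1 / (k + 1) : ℝ) = ε / (k * ε + ε) := by
    have : (k : ℝ) + 1 ≠ 0 := by positivity
    field_simp
  refine ⟨by positivity, ?_, by nlinarith, ?_, ?_⟩
  · nlinarith [mul_le_mul_of_nonneg_left hk h0.le]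
  · rw [hp]
    gcongr
    linarith
  · rw [hp]
    have hd : (2 + ε - k * ε) * (1 / (4 * (2 + ε) * (1 + ε))) ≤
        (2 + ε - k * ε) * (3 / 32 * (4 / 3 - 2 / 3 * ε)) := by
      refine mul_le_mul_of_nonneg_left ?_ (by linarith)
      rw [div_le_iff₀ (by positivity)]
      nlinarith [mul_nonneg h0.le (sub_nonneg.2 h1),
        mul_nonneg (mul_nonneg h0.le h0.le) (sub_nonneg.2 h1)]
    -- The left side minus its value at `kε = 2 + ε` is exactly proportional to `2 + ε - kε`, and `W
    -- - w = 3/32 · ε (2 + ε - kε)`.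
    have he : ε / (k * ε + ε) / 2 ≤ ε / (4 * (1 + ε)) +
        ε * ((2 + ε - k * ε) * (1 / (4 * (2 + ε) * (1 + ε)))) := by
      have hx : 0 < k * ε + ε := by linarith
      have hsub : ε / (k * ε + ε) / 2 - ε / (4 * (1 + ε)) =
          ε * ((2 + ε - k * ε) * (1 / (4 * (k * ε + ε) * (1 + ε)))) := by
        field_simp
        ring
      have hle : ε * ((2 + ε - k * ε) * (1 / (4 * (k * ε + ε) * (1 + ε)))) ≤
          ε * ((2 + ε - k * ε) * (1 / (4 * (2 + ε) * (1 + ε)))) := by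
        have : 0 ≤ 2 + ε - k * ε := by linarith
        gcongr
      linarith
    nlinarith [mul_le_mul_of_nonneg_left hd h0.le]

lemma tiltBound_le {w : ℝ} {lam : ℝ} (hw : w = lam * k / 2) (hw0 : 0 ≤ w) (hw1 : w ≤ 1) :
    tiltBound k lam ≤ k + 2 * w * ((1 / (k + 1) : ℝ) / 2 * (1 + w ^ 2 / 6 + 5 * w ^ 3 / 96) +
      (w + 5 * w ^ 3 / 48) / 2) := by
  have hs := Real.sinh_le_quartic hw0 hw1
  have hc := Real.cosh_le_quartic hw0 hw1
  have hs2 : Real.sinh w / (k + 1) ≤ w * (1 + w ^ 2 / 6 + 5 * w ^ 3 / 96) / (k + 1) := by gcongr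
  rw [tiltBound, ← hw]
  have he : w * (1 + w ^ 2 / 6 + 5 * w ^ 3 / 96) / (k + 1) =
    2 * w * ((1 / (k + 1) : ℝ) / 2 * (1 + w ^ 2 / 6 + 5 * w ^ 3 / 96)) := by ring
  linarith

lemma upper_rate_le (h0 : 0 < ε) (h1 : ε ≤ 1) (hk2 : 2 ≤ k * ε) (hk : k * ε ≤ 2 + ε) {lam : ℝ}
    (hlam : lam = 3 / 16 * ε ^ 2) :
    tiltBound k lam + (Real.exp (lam * k) - 1) * (1 + (Real.exp (lam * k / 2) - 1) / k) ≤
      k * Real.exp (lam * rateFactor ε + lam) := by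
  obtain ⟨hw0, hwW, hW1, hp, hpw⟩ := rate_parameter_bounds h0 h1 hk2 hk
  rw [← hlam] at hw0 hwW hpw
  have hk0 : (0 : ℝ) < k := by
    by_contra hc
    nlinarith
  have hlam0 : 0 ≤ lam := by rw [hlam]; positivity
  obtain ⟨hθ0, -⟩ := rateFactor_mem h0 h1
  have hpoly := upper_rate_polynomial h0 h1 hw0 rfl hwW hp hpw
  set w := lam * k / 2 with hw
  have hC := tiltBound_le (k := k) hw hw0 (by linarith)
  have hE : Real.exp (lam * k) - 1 ≤
      2 * w * (1 + w + 2 / 3 * w ^ 2 + w ^ 3 / 3 + 4 / 25 * w ^ 4) := by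
    have h := Real.exp_le_quintic (x := lam * k) (by linarith) (by linarith)
    rw [show lam * k = 2 * w by rw [hw]; ring] at h ⊢
    linarith
  have hE0 : 0 ≤ Real.exp (lam * k) - 1 := sub_nonneg.2 (Real.one_le_exp (by positivity))
  have hP : (Real.exp w - 1) / k ≤
      3 / 32 * ε ^ 2 * (1 + w / 2 + w ^ 2 / 6 + 5 * w ^ 3 / 96) := by
    have h := Real.exp_le_quartic hw0 (by linarith)
    rw [div_le_iff₀ hk0]
    have h2 : 3 / 32 * ε ^ 2 * k = w := by rw [hw, hlam]; ring
    calc Real.exp w - 1 ≤ w * (1 + w / 2 + w ^ 2 / 6 + 5 * w ^ 3 / 96) := by linarith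
      _ = _ := by linear_combination (1 + w / 2 + w ^ 2 / 6 + 5 * w ^ 3 / 96) * (-h2)
  have hP0 : 0 ≤ (Real.exp w - 1) / k := div_nonneg (sub_nonneg.2 (Real.one_le_exp hw0)) hk0.le
  have hprod : (Real.exp (lam * k) - 1) * (1 + (Real.exp w - 1) / k) ≤
      2 * w * (1 + w + 2 / 3 * w ^ 2 + w ^ 3 / 3 + 4 / 25 * w ^ 4) *
        (1 + 3 / 32 * ε ^ 2 * (1 + w / 2 + w ^ 2 / 6 + 5 * w ^ 3 / 96)) := by gcongr
  have hexp := Real.quadratic_le_exp_of_nonneg (x := lam * rateFactor ε + lam) (by positivity)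
  have hexp2 := mul_le_mul_of_nonneg_left hexp hk0.le
  have hid : (k : ℝ) * (1 + (lam * rateFactor ε + lam) + (lam * rateFactor ε + lam) ^ 2 / 2) =
      k + 2 * w * (1 + rateFactor ε + 3 / 32 * ε ^ 2 * (1 + rateFactor ε) ^ 2) := by
    rw [hw, hlam]; ring
  have hpoly2 := mul_le_mul_of_nonneg_left hpoly (by linarith : 0 ≤ 2 * w)
  have hfold : 13 / 24 * ε - ε ^ 3 / 256 = rateFactor ε := rfl
  rw [hfold] at hpoly2
  linarith

/-- The bounding expression `k (1 - w/2 + w²/6)/(k+1)` is largest at `kε = 2 + ε`, where `k/(k+1) =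
(2+ε)/(2+2ε)`. -/
lemma one_sub_exp_neg_div_le (h0 : 0 < ε) (h1 : ε ≤ 1) (hk2 : 2 ≤ k * ε) (hk : k * ε ≤ 2 + ε)
    {w : ℝ} (hw0 : 0 ≤ w) (hw1 : w ≤ 1) (hw : w = 3 / 32 * ε ^ 2 * k) :
    (1 - Real.exp (-w)) / (k + 1) ≤ 3 / 32 * ε ^ 2 * ((2 + ε) / (2 + 2 * ε)) *
      (1 - 3 / 32 * ε * (2 + ε) / 2 + (3 / 32 * ε * (2 + ε)) ^ 2 / 6) ∧
    3 / 32 * ε ^ 2 * ((2 + ε) / (2 + 2 * ε)) *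
      (1 - 3 / 32 * ε * (2 + ε) / 2 + (3 / 32 * ε * (2 + ε)) ^ 2 / 6) ≤ 1 := by
  set W := 3 / 32 * ε * (2 + ε) with hWdef
  constructor
  · have h := Real.cubic_le_exp_neg hw0 hw1
    have h3 : (k : ℝ) * (1 - w / 2 + w ^ 2 / 6) * (2 + 2 * ε) ≤
        (2 + ε) * (1 - W / 2 + W ^ 2 / 6) * (k + 1) := by
      obtain ⟨x, hx⟩ : ∃ x : ℝ, x = k * ε := ⟨_, rfl⟩
      rw [← hx] at hk2 hk
      have hwx : w = 3 / 32 * ε * x := by rw [hw, hx]; ring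
      have hxX : x * (2 + ε) + ε * (2 + ε + x) ≤ 15 := by nlinarith
      have hbr : 0 ≤ ε - 3 / 64 * ε * (x * (2 + ε) + ε * (2 + ε + x)) := by nlinarith
      have hcube : 0 ≤ (3 / 32 * ε) ^ 2 / 6 *
          (x * (2 + ε) * (2 + ε + x) + ε * ((2 + ε) ^ 2 + x * (2 + ε) + x ^ 2)) := by
        have : 0 ≤ x := by linarith
        positivity
      -- The difference of the two sides, times `ε`, has the factor `2 + ε - kε`.
      have hkey := mul_nonneg (sub_nonneg.2 hk) (add_nonneg hbr hcube)
      refine le_of_mul_le_mul_right ?_ h0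
      have e1 : (k : ℝ) * (1 - w / 2 + w ^ 2 / 6) * (2 + 2 * ε) * ε =
          x * (1 - w / 2 + w ^ 2 / 6) * (2 + 2 * ε) := by rw [hx]; ring
      have e2 : (2 + ε) * (1 - W / 2 + W ^ 2 / 6) * (k + 1) * ε =
          (2 + ε) * (1 - W / 2 + W ^ 2 / 6) * (x + ε) := by rw [hx]; ring
      rw [e1, e2, hwx, hWdef, ← sub_nonneg]
      refine hkey.trans (le_of_eq ?_)
      ring
    rw [div_le_iff₀ (by positivity)]
    calc 1 - Real.exp (-w) ≤ w * (1 - w / 2 + w ^ 2 / 6) := by linarith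
      _ = 3 / 32 * ε ^ 2 * (k * (1 - w / 2 + w ^ 2 / 6) * (2 + 2 * ε)) / (2 + 2 * ε) := by
          rw [eq_div_iff (by positivity)]
          linear_combination (1 - w / 2 + w ^ 2 / 6) * (2 + 2 * ε) * hw
      _ ≤ 3 / 32 * ε ^ 2 * ((2 + ε) * (1 - W / 2 + W ^ 2 / 6) * (k + 1)) / (2 + 2 * ε) := by
          gcongr
      _ = _ := by ring
  · have hr : (2 + ε) / (2 + 2 * ε) ≤ 1 := by rw [div_le_one (by linarith)]; linarith
    have hr0 : 0 ≤ (2 + ε) / (2 + 2 * ε) := by positivity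
    have hW0 : 0 ≤ W := by positivity
    have hW1 : W ≤ 1 := by nlinarith
    have hs : 1 - W / 2 + W ^ 2 / 6 ≤ 1 := by nlinarith
    have hs0 : 0 ≤ 1 - W / 2 + W ^ 2 / 6 := by nlinarith
    calc _ ≤ 3 / 32 * (1 : ℝ) ^ 2 * 1 * 1 := by gcongr
      _ ≤ _ := by norm_num

lemma lower_rate_le (h0 : 0 < ε) (h1 : ε ≤ 1) (hk2 : 2 ≤ k * ε) (hk : k * ε ≤ 2 + ε) {lam : ℝ}
    (hlam : lam = 3 / 16 * ε ^ 2) :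
    tiltBound k lam -
      (1 - Real.exp (-(lam * k))) * (1 - (1 - Real.exp (-(lam * k / 2))) / (k + 1)) ≤
      k * Real.exp (lam * rateFactor ε - lam) := by
  obtain ⟨hw0, hwW, hW1, hp, hpw⟩ := rate_parameter_bounds h0 h1 hk2 hk
  rw [← hlam] at hw0 hwW hpw
  have hk0 : (0 : ℝ) < k := by
    by_contra hc
    nlinarith
  have hlam0 : 0 ≤ lam := by rw [hlam]; positivity
  have hlam1 : lam ≤ 1 := by rw [hlam]; nlinarith
  obtain ⟨hθ0, hθ1⟩ := rateFactor_mem h0 h1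
  have hpoly := lower_rate_polynomial h0 h1 hw0 rfl hwW hp hpw rfl
  set w := lam * k / 2 with hw
  have hw1 : w ≤ 1 := by linarith
  have hw2 : w = 3 / 32 * ε ^ 2 * k := by rw [hw, hlam]; ring
  set W := 3 / 32 * ε * (2 + ε) with hWdef
  set ν := 3 / 32 * ε ^ 2 * ((2 + ε) / (2 + 2 * ε)) * (1 - W / 2 + W ^ 2 / 6) with hνdef
  have hC := tiltBound_le (k := k) hw hw0 (by linarith)
  have hD : 2 * w * (1 - w + 2 / 3 * w ^ 2 - w ^ 3 / 3 - 4 / 25 * w ^ 4) ≤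
      1 - Real.exp (-(lam * k)) := by
    have h := Real.exp_neg_le_quintic (x := lam * k) (by linarith) (by linarith)
    rw [show lam * k = 2 * w by rw [hw]; ring] at h ⊢
    linarith
  have hD0 : 0 ≤ 1 - Real.exp (-(lam * k)) := by
    rw [sub_nonneg, Real.exp_le_one_iff]
    linarith
  obtain ⟨hN, hν1⟩ := one_sub_exp_neg_div_le h0 h1 hk2 hk hw0 hw1 hw2
  rw [← hWdef, ← hνdef] at hN hν1
  have hprod : 2 * w * (1 - w + 2 / 3 * w ^ 2 - w ^ 3 / 3 - 4 / 25 * w ^ 4) * (1 - ν) ≤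
      (1 - Real.exp (-(lam * k))) * (1 - (1 - Real.exp (-w)) / (k + 1)) :=
    (mul_le_mul_of_nonneg_right hD (by linarith)).trans
      (mul_le_mul_of_nonneg_left (by linarith) hD0)
  have hexp := Real.cubic_le_exp_neg (x := lam * (1 - rateFactor ε))
    (mul_nonneg hlam0 (by linarith)) (mul_le_one₀ hlam1 (by linarith) (by linarith))
  rw [show -(lam * (1 - rateFactor ε)) = lam * rateFactor ε - lam by ring] at hexp
  have hexp2 := mul_le_mul_of_nonneg_left hexp hk0.le
  have hid : (k : ℝ) * (1 - lam * (1 - rateFactor ε) + (lam * (1 - rateFactor ε)) ^ 2 / 2 -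
      (lam * (1 - rateFactor ε)) ^ 3 / 6) =
      k + 2 * w * (-(1 - rateFactor ε) + 3 / 32 * ε ^ 2 * (1 - rateFactor ε) ^ 2 -
        (3 / 16 * ε ^ 2) ^ 2 / 6 * (1 - rateFactor ε) ^ 3) := by
    rw [hw, hlam]; ring
  have hpoly2 := mul_le_mul_of_nonneg_left hpoly (by linarith : 0 ≤ 2 * w)
  have hfold : 13 / 24 * ε - ε ^ 3 / 256 = rateFactor ε := rfl
  rw [hfold] at hpoly2
  linarith

lemma base_rate_le (h0 : 0 < ε) (h1 : ε ≤ 1) (hk2 : 2 ≤ k * ε) (hk : k * ε ≤ 2 + ε) {lam : ℝ}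
    (hlam : lam = 3 / 16 * ε ^ 2) :
    tiltBound k lam ≤ k * Real.exp (lam * rateFactor ε) * (1 - 6 / 10 * lam ^ 2) := by
  obtain ⟨hw0, hwW, hW1, hp, hpw⟩ := rate_parameter_bounds h0 h1 hk2 hk
  rw [← hlam] at hw0 hwW hpw
  have hlam0 : 0 ≤ lam := by rw [hlam]; positivity
  have hlam1 : lam ≤ 3 / 16 := by rw [hlam]; nlinarith
  obtain ⟨hθ0, hθ1⟩ := rateFactor_mem h0 h1
  have hpoly := base_rate_polynomial h0 h1 hw0 rfl hwW hp
  set w := lam * k / 2 with hw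
  have hC := tiltBound_le (k := k) hw hw0 (by linarith)
  have hpoly2 := mul_le_mul_of_nonneg_left hpoly (by linarith : 0 ≤ 2 * w)
  have hfold : 13 / 24 * ε - ε ^ 3 / 256 = rateFactor ε := rfl
  rw [hfold, ← hlam] at hpoly2
  have hexp := Real.add_one_le_exp (lam * rateFactor ε)
  have hs : 0 ≤ 1 - 6 / 10 * lam ^ 2 := by nlinarith
  have hk0 : (0 : ℝ) ≤ k := Nat.cast_nonneg k
  have h2 : k * (lam * rateFactor ε + 1) * (1 - 6 / 10 * lam ^ 2) ≤
      k * Real.exp (lam * rateFactor ε) * (1 - 6 / 10 * lam ^ 2) := by gcongr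
  refine le_trans ?_ h2
  have h3 : lam * rateFactor ε + 1 ≤ 9 / 8 := by nlinarith
  have h4 := mul_le_mul_of_nonneg_left h3 (by positivity : 0 ≤ k * (6 / 10 * lam ^ 2))
  have h5 : 2 * w = lam * k := by rw [hw]; ring
  rw [h5] at hC hpoly2
  linarith

/-- At `y = 0` the tangent of `exp(λy)` taken at `y = 1` has the value `e^λ (1 - λ)`; the loss is
quadratic in `λ` and is covered by `base_rate_le`. -/
lemma one_sub_mul_exp_ge {x : ℝ} (h0 : 0 ≤ x) (h1 : x ≤ 3 / 16) :
    1 - 6 / 10 * x ^ 2 ≤ Real.exp x * (1 - x) := by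
  have h := mul_le_mul_of_nonneg_right (Real.quadratic_le_exp_of_nonneg h0)
    (by linarith : 0 ≤ 1 - x)
  nlinarith [mul_nonneg h0 h0, mul_nonneg (mul_nonneg h0 h0) (by linarith : 0 ≤ 3 / 16 - x)]

lemma one_add_mul_exp_neg_ge {x : ℝ} (h0 : 0 ≤ x) (h1 : x ≤ 3 / 16) :
    1 - 6 / 10 * x ^ 2 ≤ Real.exp (-x) * (1 + x) := by
  have h := mul_le_mul_of_nonneg_right (Real.cubic_le_exp_neg h0 (by linarith))
    (by linarith : 0 ≤ 1 + x)
  nlinarith [mul_nonneg h0 h0, mul_nonneg (mul_nonneg h0 h0) (by linarith : 0 ≤ 3 / 16 - x),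
    pow_nonneg h0 3, mul_nonneg (pow_nonneg h0 3) (by linarith : 0 ≤ 3 / 16 - x)]

/-- The left sides are affine in `y` and the exponentials lie above their tangents at `y = 1`. It
therefore suffices to compare at the two endpoints: `upper_rate_le` and `lower_rate_le` at 1,
`base_rate_le` at 0. -/
lemma isGrowthRate (h0 : 0 < ε) (h1 : ε ≤ 1) (hk2 : 2 ≤ k * ε) (hk : k * ε ≤ 2 + ε) :
    IsGrowthRate k (3 / 16 * ε ^ 2) (Real.exp (3 / 16 * ε ^ 2 * rateFactor ε)) := by
  obtain ⟨lam, hlam⟩ : ∃ lam : ℝ, lam = 3 / 16 * ε ^ 2 := ⟨_, rfl⟩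
  have hu := upper_rate_le h0 h1 hk2 hk hlam
  have hl := lower_rate_le h0 h1 hk2 hk hlam
  have hb := base_rate_le h0 h1 hk2 hk hlam
  rw [← hlam]
  have hlam0 : 0 ≤ lam := by rw [hlam]; positivity
  have hlam1 : lam ≤ 3 / 16 := by rw [hlam]; nlinarith
  have hK : 0 ≤ k * Real.exp (lam * rateFactor ε) := by positivity
  rw [Real.exp_add] at hu
  rw [sub_eq_add_neg (lam * rateFactor ε), Real.exp_add] at hl
  refine ⟨fun y hy => ?_, fun y hy => ?_⟩
  · have hb2 := hb.trans (mul_le_mul_of_nonneg_left (one_sub_mul_exp_ge hlam0 hlam1) hK)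
    have htan : Real.exp lam * (1 - lam * (1 - y)) ≤ Real.exp (lam * y) := by
      have := Real.add_one_le_exp (-(lam * (1 - y)))
      calc _ ≤ Real.exp lam * Real.exp (-(lam * (1 - y))) := by gcongr; linarith
        _ = _ := by rw [← Real.exp_add]; ring_nf
    have h2 := mul_le_mul_of_nonneg_left htan hK
    have h3 := mul_le_mul_of_nonneg_left hu hy.1
    have h4 := mul_le_mul_of_nonneg_left hb2 (sub_nonneg.2 hy.2)
    linarith
  · have hb2 := hb.trans (mul_le_mul_of_nonneg_left (one_add_mul_exp_neg_ge hlam0 hlam1) hK)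
    have htan : Real.exp (-lam) * (1 + lam * (1 - y)) ≤ Real.exp (-(lam * y)) := by
      have := Real.add_one_le_exp (lam * (1 - y))
      calc _ ≤ Real.exp (-lam) * Real.exp (lam * (1 - y)) := by gcongr; linarith
        _ = _ := by rw [← Real.exp_add]; ring_nf
    have h2 := mul_le_mul_of_nonneg_left htan hK
    have h3 := mul_le_mul_of_nonneg_left hl hy.1
    have h4 := mul_le_mul_of_nonneg_left hb2 (sub_nonneg.2 hy.2)
    linarith

end Rate

end ImportWeightMW

/-! ### From counting draws to probability. -/

/-- A set of a product space all of whose sections have measure at least `c` has measure at least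
`c`, whether or not it is measurable. -/
lemma MeasureTheory.Measure.le_prod_of_forall_le_section {Ω X : Type*} [MeasurableSpace Ω]
    [MeasurableSpace X] (μ : MeasureTheory.Measure Ω) [MeasureTheory.IsProbabilityMeasure μ]
    (ν : MeasureTheory.Measure X) [MeasureTheory.SFinite ν] {S : Set (Ω × X)} {c : ENNReal}
    (h : ∀ ω, c ≤ ν (Prod.mk ω ⁻¹' S)) : c ≤ μ.prod ν S := by
  -- Integration over sections needs a measurable set; the measurable hull has the same measure and
  -- larger sections.
  rw [← MeasureTheory.measure_toMeasurable S,
    MeasureTheory.Measure.prod_apply (MeasureTheory.measurableSet_toMeasurable _ _)]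
  calc c = ∫⁻ _, c ∂μ := by simp
    _ ≤ _ := MeasureTheory.lintegral_mono fun ω => (h ω).trans
      (MeasureTheory.measure_mono (Set.preimage_mono (MeasureTheory.subset_toMeasurable _ _)))

lemma ProbabilityTheory.le_uniformOn_univ {X : Type*} [Fintype X] [Nonempty X] [MeasurableSpace X]
    [MeasurableSingletonClass X] (p : X → Prop) [DecidablePred p] {c : ℝ}
    (h : c * Fintype.card X ≤ (Finset.univ.filter p).card) :
    ENNReal.ofReal c ≤ ProbabilityTheory.uniformOn (Set.univ : Set X) {x | p x} := by
  have hS : {x | p x} = ((Finset.univ.filter p : Finset X) : Set X) := by ext; simp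
  have hX : (0 : ℝ) < Fintype.card X := by exact_mod_cast Fintype.card_pos
  rw [ProbabilityTheory.uniformOn_univ, hS, MeasureTheory.Measure.count_apply_finset,
    ← ENNReal.ofReal_natCast, ← ENNReal.ofReal_natCast (Fintype.card X),
    ← ENNReal.ofReal_div_of_pos hX]
  exact ENNReal.ofReal_le_ofReal ((le_div_iff₀ hX).2 h)

namespace ImportWeightMW

/-! ### Deterministic error bound for `k ≤ 2`. -/

section Bounded

variable {n : ℕ} [NeZero n] {k : ℕ} {η : ℝ}

/-- With `k ≤ 2` the halved response is at most the true answer. The critical case has both indices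
at the queried position: the midpoint is then `k y ≤ 2y`, and `y ≤ v i` gives `2y - v i ≤ y ≤ 1`. -/
lemma abs_half_response_sub_le {w v : Fin n → ℝ} (hm : Monotone v)
    (hv : ∀ i, v i ∈ Set.Icc (0 : ℝ) 1) (hk : k ≤ 2) (m : Fin k) (i : Fin n) :
    |(response w v m (lowerIndex k w i) + response w v m (upperIndex k w i)) / 2 - v i| ≤ 1 := by
  have hk2 : (k : ℝ) ≤ 2 := by exact_mod_cast hk
  have hl := lowerIndex_le k w i
  have hY := trueAnswer_mem (k := k) (w := w) hv (m + 1)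
  have hlow := trueAnswer_lowerIndex_le (k := k) (w := w) hm hv i
  have hvi := hv i
  simp only [Set.mem_Icc] at hY hvi
  have hkY0 : 0 ≤ k * trueAnswer k w v (m + 1) := mul_nonneg (Nat.cast_nonneg k) hY.1
  have hkY : k * trueAnswer k w v (m + 1) ≤ 2 * trueAnswer k w v (m + 1) :=
    mul_le_mul_of_nonneg_right hk2 hY.1
  rw [abs_le]
  by_cases h1 : (m : ℕ) + 1 = lowerIndex k w i
  · rw [← h1, response_self]
    rw [← h1] at hlow
    by_cases h2 : (m : ℕ) + 1 = upperIndex k w i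
    · rw [← h2, response_self]
      constructor <;> linarith
    · by_cases h3 : upperIndex k w i = k + 1
      · rw [h3, response_last]
        constructor <;> linarith
      · rw [response_of_ne h3 h2]
        constructor <;> linarith
  · rw [response_of_ne (by omega) h1]
    by_cases h2 : (m : ℕ) + 1 = upperIndex k w i
    · rw [← h2, response_self]
      constructor <;> linarith
    · by_cases h3 : upperIndex k w i = k + 1
      · rw [h3, response_last]
        constructor <;> linarith
      · rw [response_of_ne h3 h2]
        constructor <;> linarith

lemma abs_deviation_le (s : List (Fin n) → Fin n → ℝ) (hm : ∀ h, Monotone (s h))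
    (hv : ∀ h i, s h i ∈ Set.Icc (0 : ℝ) 1) (hk : k ≤ 2) (T : ℕ) (m : Fin T → Fin k) (i : Fin n) :
    |sums ((importWeightMW n k η).run s T m) i / 2 -
      ((importWeightMW n k η).run s T m).total i| ≤ T := by
  induction T with
  | zero => simp [TQMAlgorithm.run, sums, importWeightMW]
  | succ T ih =>
    set c := (importWeightMW n k η).run s T (fun t => m t.castSucc) with hc
    have hrun : (importWeightMW n k η).run s (T + 1) m =
        (importWeightMW n k η).step s c (m (Fin.last T)) := rfl
    have h1 := ih (fun t => m t.castSucc)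
    have h2 := abs_half_response_sub_le (w := weights c) (hm c.history) (hv c.history) hk
      (m (Fin.last T)) i
    rw [hrun, sums_step, total_step]
    rw [← hc] at h1
    rw [abs_le] at h1 h2 ⊢
    push_cast
    constructor <;> linarith [h1.1, h1.2, h2.1, h2.2]

lemma norm_estimate_sub_le_iff (s : List (Fin n) → Fin n → ℝ) {T : ℕ} (hT : 0 < T) {ε : ℝ}
    (hε : 0 ≤ ε) (m : Fin T → Fin k) :
    ‖(importWeightMW n k η).estimate s T m - (importWeightMW n k η).empiricalCDF s T m‖ ≤ ε ↔
      ∀ i, |sums ((importWeightMW n k η).run s T m) i / 2 -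
        ((importWeightMW n k η).run s T m).total i| ≤ ε * T := by
  have hT' : (0 : ℝ) < T := by exact_mod_cast hT
  rw [pi_norm_le_iff_of_nonneg hε]
  refine forall_congr' fun i => ?_
  have h : ((importWeightMW n k η).estimate s T m -
      (importWeightMW n k η).empiricalCDF s T m) i =
      (sums ((importWeightMW n k η).run s T m) i / 2 -
        ((importWeightMW n k η).run s T m).total i) / T := by
    change 1 / (2 * (T : ℝ)) * sums ((importWeightMW n k η).run s T m) i -
      ((importWeightMW n k η).run s T m).total i / T = _
    field_simp
  rw [h, Real.norm_eq_abs, abs_div, abs_of_pos hT', div_le_iff₀ hT']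

end Bounded

/-! ### Tail bound, union bound and conclusion. -/

section Accuracy

/-- The exponent `κ` with `(1 + ε²/16) ^ κ = exp (λ / 2)`, where `λ = 3 ε² / 16`. -/
def potentialExponent (ε : ℝ) : ℝ := 3 / 16 * ε ^ 2 / 2 / Real.log (1 + ε ^ 2 / 16)

lemma log_one_add_sq_pos {ε : ℝ} (h0 : 0 < ε) : 0 < Real.log (1 + ε ^ 2 / 16) :=
  Real.log_pos (by have : 0 < ε ^ 2 := by positivity
                   linarith)

lemma potentialExponent_mul_log {ε : ℝ} (h0 : 0 < ε) :
    potentialExponent ε * Real.log (1 + ε ^ 2 / 16) = 3 / 16 * ε ^ 2 / 2 :=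
  div_mul_cancel₀ _ (log_one_add_sq_pos h0).ne'

lemma one_le_potentialExponent {ε : ℝ} (h0 : 0 < ε) : 1 ≤ potentialExponent ε := by
  have hε : 0 < ε ^ 2 := by positivity
  have h := Real.log_le_sub_one_of_pos (by positivity : 0 < 1 + ε ^ 2 / 16)
  rw [potentialExponent, le_div_iff₀ (log_one_add_sq_pos h0)]
  linarith

/-- From `log(1 + x) ≥ 2x/(x + 2)` at `x = ε²/16`. -/
lemma potentialExponent_le {ε : ℝ} (h0 : 0 < ε) :
    potentialExponent ε ≤ 3 / 2 + 3 / 64 * ε ^ 2 := by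
  have hε : 0 < ε ^ 2 := by positivity
  have h := Real.le_log_one_add_of_nonneg (x := ε ^ 2 / 16) (by positivity)
  rw [potentialExponent, div_le_iff₀ (log_one_add_sq_pos h0)]
  rw [div_le_iff₀ (by positivity)] at h
  linarith

/-- `λ(ε - θ) = ε³ (11/128 + 3ε²/4096)`, and `ε³T ≥ 64 log n` turns this into `(11/2 + 3ε²/64) log
n`. Subtracting the bound `3/2 + 3ε²/64` on `κ` leaves exactly `4 log n`; the cubic term of
`rateFactor` matches the `ε²` term of `κ`. -/
lemma tail_factor_le {n : ℕ} (hn : 2 ≤ n) {ε : ℝ} (h0 : 0 < ε) {T : ℕ}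
    (hT : 64 * Real.log n / ε ^ 3 ≤ T) :
    Real.exp (3 / 16 * ε ^ 2 * rateFactor ε) ^ T * (n : ℝ) ^ potentialExponent ε ≤
      1 / (n : ℝ) ^ 4 * Real.exp (3 / 16 * ε ^ 2 * (ε * T)) := by
  have hn0 : (0 : ℝ) < n := by positivity
  have hlog : 0 ≤ Real.log n := Real.log_natCast_nonneg n
  have hκ := mul_le_mul_of_nonneg_right (potentialExponent_le h0) hlog
  rw [div_le_iff₀ (by positivity)] at hT
  have h4 : 1 / (n : ℝ) ^ 4 = Real.exp (-(4 * Real.log n)) := by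
    rw [Real.exp_neg, one_div, mul_comm, Real.exp_mul, Real.exp_log hn0]
    norm_cast
  rw [h4, ← Real.exp_nat_mul, Real.rpow_def_of_pos hn0, ← Real.exp_add, ← Real.exp_add,
    Real.exp_le_exp]
  have hT2 := mul_le_mul_of_nonneg_right hT (by positivity : 0 ≤ 11 / 128 + 3 / 4096 * ε ^ 2)
  unfold rateFactor
  linarith

variable {n : ℕ} [NeZero n]

open Classical in
lemma card_inaccurate_le (hn : 2 ≤ n) {ε : ℝ} (h0 : 0 < ε) (h1 : ε ≤ 1) {k T : ℕ}
    (hk2 : 2 ≤ k * ε) (hk : k * ε ≤ 2 + ε) (hT : 64 * Real.log n / ε ^ 3 ≤ T)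
    {s : List (Fin n) → Fin n → ℝ} (hm : ∀ h, Monotone (s h))
    (hv : ∀ h i, s h i ∈ Set.Icc (0 : ℝ) 1) :
    ((Finset.univ.filter fun m : Fin T → Fin k => ¬ ∀ i,
      |sums ((importWeightMW n k (ε ^ 2 / 16)).run s T m) i / 2 -
        ((importWeightMW n k (ε ^ 2 / 16)).run s T m).total i| ≤ ε * T).card : ℝ) ≤
      (k : ℝ) ^ T / 4 := by
  set A := importWeightMW n k (ε ^ 2 / 16) with hA
  have hη : 0 ≤ ε ^ 2 / 16 := by positivity
  have hκ := one_le_potentialExponent h0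
  have hlam : 0 < 3 / 16 * ε ^ 2 := by positivity
  have hrate := isGrowthRate h0 h1 hk2 hk
  have htail := mul_le_mul_of_nonneg_left (tail_factor_le hn h0 hT)
    (by positivity : (0 : ℝ) ≤ (k : ℝ) ^ T)
  have hn0 : (0 : ℝ) < n := by positivity
  have hone : ∀ (Φ : A.Config → ℝ) (i : Fin n), Φ ⟨A.init, [], fun _ => 0⟩ = 0 →
      (∀ c, (∀ j, 0 < weights c j) →
        ∑ m : Fin k, Real.exp (3 / 16 * ε ^ 2 * Φ (A.step s c m)) *
          weightRatio (A.step s c m) i ^ potentialExponent ε ≤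
        k * Real.exp (3 / 16 * ε ^ 2 * rateFactor ε) *
          (Real.exp (3 / 16 * ε ^ 2 * Φ c) * weightRatio c i ^ potentialExponent ε)) →
      ((Finset.univ.filter fun m : Fin T → Fin k => ε * T < Φ (A.run s T m)).card : ℝ) ≤
        (k : ℝ) ^ T * (1 / (n : ℝ) ^ 4) := by
    intro Φ i hΦ0 hΦ
    have h := card_deviation_le (x := ε * T) s hη (by linarith) (Real.exp_pos _).le hlam i hΦ0 hΦ T
    rw [mul_pow, mul_assoc ((k : ℝ) ^ T)] at h
    exact le_of_mul_le_mul_right (h.trans (htail.trans_eq (mul_assoc _ _ _).symm))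
      (Real.exp_pos _)
  have hup := fun i => hone (fun c => sums c i / 2 - c.total i) i
    (by change (0 : ℝ) / 2 - 0 = 0; norm_num) (fun c hc =>
      sum_upper_potential_step_le hm hv hη hκ (potentialExponent_mul_log h0) hlam.le hrate i hc)
  have hlow := fun i => hone (fun c => c.total i - sums c i / 2) i
    (by change (0 : ℝ) - 0 / 2 = 0; norm_num) (fun c hc =>
      sum_lower_potential_step_le hm hv hη hκ (potentialExponent_mul_log h0) hlam.le hrate i hc)
  have hsub : (Finset.univ.filter fun m : Fin T → Fin k => ¬ ∀ i,
      |sums (A.run s T m) i / 2 - (A.run s T m).total i| ≤ ε * T) ⊆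
      Finset.univ.biUnion fun i =>
        (Finset.univ.filter fun m : Fin T → Fin k =>
          ε * T < sums (A.run s T m) i / 2 - (A.run s T m).total i) ∪
        (Finset.univ.filter fun m : Fin T → Fin k =>
          ε * T < (A.run s T m).total i - sums (A.run s T m) i / 2) := by
    intro m hmem
    obtain ⟨i, hi⟩ := not_forall.1 (Finset.mem_filter.1 hmem).2
    rw [Finset.mem_biUnion]
    refine ⟨i, Finset.mem_univ i, ?_⟩
    rw [Finset.mem_union, Finset.mem_filter_univ, Finset.mem_filter_univ]
    rcases lt_abs.1 (not_le.1 hi) with h | h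
    · exact Or.inl h
    · exact Or.inr (by linarith)
  have hcard := (Finset.card_le_card hsub).trans Finset.card_biUnion_le
  calc _ ≤ ((∑ i : Fin n, ((Finset.univ.filter fun m : Fin T → Fin k =>
          ε * T < sums (A.run s T m) i / 2 - (A.run s T m).total i) ∪
        (Finset.univ.filter fun m : Fin T → Fin k =>
          ε * T < (A.run s T m).total i - sums (A.run s T m) i / 2)).card : ℕ) : ℝ) := by
        exact_mod_cast hcard
    _ ≤ ∑ _i : Fin n, ((k : ℝ) ^ T * (1 / (n : ℝ) ^ 4) + (k : ℝ) ^ T * (1 / (n : ℝ) ^ 4)) := by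
        rw [Nat.cast_sum]
        refine Finset.sum_le_sum fun i _ => ?_
        refine le_trans ?_ (add_le_add (hup i) (hlow i))
        exact_mod_cast Finset.card_union_le _ _
    _ = (k : ℝ) ^ T * (2 / (n : ℝ) ^ 3) := by
        rw [Finset.sum_const, Finset.card_univ, Fintype.card_fin, nsmul_eq_mul]
        field_simp
        ring
    _ ≤ (k : ℝ) ^ T * (1 / 4) := by
        have hn2 : (2 : ℝ) ≤ n := by exact_mod_cast hn
        have hn3 : (2 : ℝ) ^ 3 ≤ (n : ℝ) ^ 3 := by gcongr
        have : 2 / (n : ℝ) ^ 3 ≤ 1 / 4 := by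
          rw [div_le_div_iff₀ (by positivity) (by norm_num)]
          linarith
        gcongr
    _ = _ := by ring

open Classical in
lemma three_quarters_le_card_accurate (hn : 2 ≤ n) {ε : ℝ} (h0 : 0 < ε) {T : ℕ} (hT0 : 0 < T)
    (hT : 64 * Real.log n / ε ^ 3 ≤ T)
    {s : List (Fin n) → Fin n → ℝ} (hm : ∀ h, Monotone (s h))
    (hv : ∀ h i, s h i ∈ Set.Icc (0 : ℝ) 1) :
    3 / 4 * (⌈2 / ε⌉₊ : ℝ) ^ T ≤
      ((Finset.univ.filter fun m : Fin T → Fin ⌈2 / ε⌉₊ =>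
        ‖(importWeightMW n ⌈2 / ε⌉₊ (ε ^ 2 / 16)).estimate s T m -
          (importWeightMW n ⌈2 / ε⌉₊ (ε ^ 2 / 16)).empiricalCDF s T m‖ ≤ ε).card : ℝ) := by
  set k := ⌈2 / ε⌉₊ with hkdef
  have hcard : (Finset.univ : Finset (Fin T → Fin k)).card = k ^ T := by simp
  simp_rw [norm_estimate_sub_le_iff s hT0 h0.le]
  rcases le_or_gt 1 ε with h1 | h1
  · have hk : k ≤ 2 := Nat.ceil_le.2 (by rw [div_le_iff₀ h0]; push_cast; linarith)
    rw [Finset.filter_true_of_mem, hcard]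
    · push_cast
      have : (0 : ℝ) ≤ (k : ℝ) ^ T := by positivity
      linarith
    · intro m _ i
      refine (abs_deviation_le s hm hv hk T m i).trans ?_
      exact le_mul_of_one_le_left (Nat.cast_nonneg T) h1
  · have hk2 : 2 ≤ k * ε := (div_le_iff₀ h0).1 (Nat.le_ceil _)
    have hk : k * ε ≤ 2 + ε := by
      have h := mul_le_mul_of_nonneg_right
        (Nat.ceil_lt_add_one (by positivity : 0 ≤ 2 / ε)).le h0.le
      rwa [add_mul, div_mul_cancel₀ _ h0.ne', one_mul] at h
    have hbad := card_inaccurate_le hn h0 h1.le hk2 hk hT hm hv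
    have hsum := Finset.card_filter_add_card_filter_not (s := (Finset.univ : Finset (Fin T → Fin k)))
      (fun m => ∀ i, |sums ((importWeightMW n k (ε ^ 2 / 16)).run s T m) i / 2 -
        ((importWeightMW n k (ε ^ 2 / 16)).run s T m).total i| ≤ ε * T)
    rw [hcard] at hsum
    have hsum' := congrArg (Nat.cast : ℕ → ℝ) hsum
    push_cast at hsum'
    linarith

end Accuracy

end ImportWeightMW

end

theorem mainTheorem1 (n : ℕ) [NeZero n] (hn : 2 ≤ n) (ε : ℝ) (hε : 0 < ε) :
    TQMAlgorithm.Solves.{u} (importWeightMW n ⌈2 / ε⌉₊ (ε ^ 2 / 16)) ε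
      (64 * Real.log n / ε ^ 3) := by
  classical
  intro T hT Ω _ μ _ adv
  -- Since `n ≥ 2`, the sample bound is positive, so the divisions by `T` are genuine.
  have hT0 : 0 < T := by
    have hlog : 0 < Real.log n := Real.log_pos (by exact_mod_cast hn)
    have : (0 : ℝ) < T := lt_of_lt_of_le (by positivity) hT
    exact_mod_cast this
  have hk : 0 < ⌈2 / ε⌉₊ := Nat.ceil_pos.2 (by positivity)
  have : Nonempty (Fin (importWeightMW n ⌈2 / ε⌉₊ (ε ^ 2 / 16)).coins) := ⟨⟨0, hk⟩⟩
  rw [MeasureTheory.measureReal_def, ← ENNReal.ofReal_le_iff_le_toReal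
    (MeasureTheory.measure_ne_top _ _)]
  -- The bound holds for every realization `ω` of the private randomness, so it suffices to count
  -- draws against the fixed strategy `adv.move ω`.
  refine MeasureTheory.Measure.le_prod_of_forall_le_section μ _ fun ω => ?_
  refine ProbabilityTheory.le_uniformOn_univ (fun m =>
    ‖(importWeightMW n ⌈2 / ε⌉₊ (ε ^ 2 / 16)).estimate (adv.move ω) T m -
      (importWeightMW n ⌈2 / ε⌉₊ (ε ^ 2 / 16)).empiricalCDF (adv.move ω) T m‖ ≤ ε) ?_
  have h := ImportWeightMW.three_quarters_le_card_accurate hn hε hT0 hT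
    (adv.monotone_move ω) (adv.move_mem_Icc ω)
  have hcard : (Fintype.card (Fin T → Fin (importWeightMW n ⌈2 / ε⌉₊ (ε ^ 2 / 16)).coins) : ℝ) =
      (⌈2 / ε⌉₊ : ℝ) ^ T := by
    rw [Fintype.card_fun, Fintype.card_fin, Fintype.card_fin, Nat.cast_pow]
    rfl
  rw [hcard]
  exact h
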